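/- For finite sets $A,B$ of natural numbers put $P(A,B)=\prod_{(a,b)\in A\times B,\ a<b}(b-a)$, and for $k\ge 0$ put $s(k)=2!\cdot 3!\cdots(k-1)!$ (empty products are $1$). Let $N\ge 0$, let $U,L,B\subseteq\{1,\dots,N\}$, let $V\subseteq U\cap L$, and assume $B\cap F=\emptyset$, where $F=(U\cup L)\setminus V$. Write $\overline U=U\setminus(U\cap L)$ and $\overline L=L\setminus (U\cap L)$. In the triangular lattice consider the (possibly degenerate) hexagon with a horizontal diagonal of length $N$ which has $|U|$ rows of triangles above and $|L|$ rows of triangles below the diagonal; rows above the diagonal start and end with an upwards-pointing triangle, rows below it start and end with a downwards-pointing triangle. Number the upwards-pointing triangles resting on the diagonal, and likewise the downwards-pointing triangles hanging from it, by $1,\dots,N$ from left to right. Remove the upwards-pointing triangles at the positions in $U\setminus V$ and the downwards-pointing triangles at the positions in $L\setminus V$, both along the diagonal. A lozenge is a union of two triangles sharing an edge, and a lozenge tiling is a partition of the region into lozenges. 1. Every lozenge tiling of this dented hexagon contains exactly $|V|$ vertical lozenges bisected by the horizontal diagonal, and their positions lie outside $F$. 2. The number $M_N(U,L,V,B)$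 of lozenge tilings of this dented hexagon in which all vertical lozenges bisected by the diagonal have positions in $B$ equals $$\frac{P(\overline U,\overline U)\,P(\overline L,\overline L)}{s(|U|)\,s(|L|)}\cdot\Sigma(U,L,V,B),\qquad \Sigma(U,L,V,B)=\sum_{V'\subseteq B,\ |V'|=|V|}P(\overline U\cup\overline L,X)\,P(X,\overline U\cup\overline L)\,P(X,X)^2,$$ where $X=((U\cap L)\setminus V)\cup V'$. 3. Let $S\subseteq\overline U\cup\overline L$, $U'=(U\setminus S)\cup(L\cap S)$, $L'=(L\setminus S)\cup(U\cap S)$, and let $\overline{U'}=U'\setminus(U'\cap L')$, $\overline{L'}=L'\setminus(U'\cap L')$. Then $\Sigma(U',L',V,B)=\Sigma(U,L,V,B)$. If moreover $|V|\le|B|$, then $M_N(U',L',V,B)>0$ and $$\frac{M_N(U,L,V,B)}{M_N(U',L',V,B)}=\frac{P(\overline U,\overline U)\,P(\overline L,\overline L)}{P(\overline{U'},\overline{U'})\,P(\overline{L'},\overline{L'})}\cdot\frac{s(|U'|)\,s(|L'|)}{s(|U|)\,s(|L|)}.$$ -/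

import Mathlib

namespace Lozenge

/-! ## The triangular lattice

The lattice point `(i, j) : ℤ × ℤ` stands for `i • (1, 0) + j • (1 / 2, √3 / 2)` in the plane, so
lines with constant `j` are horizontal, and `j` grows upwards. -/

/-- A unit triangle of the triangular lattice: `(i, j, true)` is the upwards-pointing triangle with
vertices `(i, j)`, `(i + 1, j)`, `(i, j + 1)`, and `(i, j, false)` is the downwards-pointing
triangle with vertices `(i + 1, j)`, `(i, j + 1)`, `(i + 1, j + 1)`. -/
abbrev Tri : Type := ℤ × ℤ × Bool

/-- The upwards-pointing triangle whose horizontal side joins `(i, j)` and `(i + 1, j)`. -/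
def up (i j : ℤ) : Tri := (i, j, true)

/-- The downwards-pointing triangle whose horizontal side joins `(i, j + 1)` and
`(i + 1, j + 1)`. -/
def down (i j : ℤ) : Tri := (i, j, false)

/-- The three corners of a triangle. -/
def vertices : Tri → Finset (ℤ × ℤ)
  | (i, j, true) => {(i, j), (i + 1, j), (i, j + 1)}
  | (i, j, false) => {(i + 1, j), (i, j + 1), (i + 1, j + 1)}

/-- Two triangles are adjacent if they share an edge, i.e. have exactly two common corners. -/
def Adjacent (s t : Tri) : Prop := (vertices s ∩ vertices t).card = 2

/-- A lozenge is the union of two adjacent triangles. -/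
def IsLozenge (b : Finset Tri) : Prop := ∃ s t : Tri, Adjacent s t ∧ b = {s, t}

/-- A partition of a region (a finite set of triangles) is a lozenge tiling if all its blocks are
lozenges. -/
def IsTiling {R : Finset Tri} (T : Finpartition R) : Prop := ∀ b ∈ T.parts, IsLozenge b

/-! ## Dented hexagons -/

/-- The lattice points of the hexagon whose horizontal diagonal is the segment from `(1, 0)` to
`(N + 1, 0)`, of length `N`, with `m` rows of triangles above and `n` rows below the diagonal. -/
def InHexagon (N m n : ℕ) (p : ℤ × ℤ) : Prop :=
  1 ≤ p.1 ∧ p.1 ≤ N + 1 ∧ 1 ≤ p.1 + p.2 ∧ p.1 + p.2 ≤ N + 1 ∧ -(n : ℤ) ≤ p.2 ∧ p.2 ≤ m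

instance (N m n : ℕ) (p : ℤ × ℤ) : Decidable (InHexagon N m n p) := by
  unfold InHexagon; infer_instance

/-- The triangles contained in the hexagon. The rows of the upper half start and end with an
upwards-pointing triangle, those of the lower half with a downwards-pointing one. -/
noncomputable def hexagon (N m n : ℕ) : Finset Tri :=
  (Finset.Icc (1 : ℤ) (N + 1) ×ˢ Finset.Icc (-(n : ℤ)) m ×ˢ Finset.univ).filter
    fun t => ∀ p ∈ vertices t, InHexagon N m n p

/-- The bounding box in the definition of `hexagon` loses nothing. -/
theorem mem_hexagon {N m n : ℕ} {t : Tri} :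
    t ∈ hexagon N m n ↔ ∀ p ∈ vertices t, InHexagon N m n p := by
  obtain ⟨i, j, b⟩ := t
  simp only [hexagon, Finset.mem_filter, Finset.mem_product, Finset.mem_Icc, Finset.mem_univ,
    and_true, and_iff_right_iff_imp]
  intro h
  cases b
  · have h1 := h (i, j + 1) (by simp [vertices])
    have h2 := h (i + 1, j) (by simp [vertices])
    simp only [InHexagon] at h1 h2
    omega
  · have h1 := h (i, j) (by simp [vertices])
    simp only [InHexagon] at h1
    omega

/-- The upwards-pointing triangle adjacent to the horizontal diagonal from above at position `k`
(positions `1, …, N` from left to right). -/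
def upAt (k : ℕ) : Tri := up k 0

/-- The downwards-pointing triangle adjacent to the horizontal diagonal from below at position
`k`. -/
def downAt (k : ℕ) : Tri := down k (-1)

/-- The vertical lozenge bisected by the horizontal diagonal at position `k`. -/
def diagLozenge (k : ℕ) : Finset Tri := {upAt k, downAt k}

/-- The hexagon with `|U|` rows above and `|L|` rows below its horizontal diagonal of length `N`,
with the upwards-pointing triangles at the positions in `U \ V` and the downwards-pointing triangles
at the positions in `L \ V` along the diagonal removed. -/
noncomputable def dentedHexagon (N : ℕ) (U L V : Finset ℕ) : Finset Tri :=
  hexagon N U.card L.card \ ((U \ V).image upAt ∪ (L \ V).image downAt)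

/-- The number of lozenge tilings of the dented hexagon in which all vertical lozenges on the
horizontal diagonal have their positions in `B`. -/
noncomputable def restrictedCount (N : ℕ) (U L V B : Finset ℕ) : ℕ :=
  Nat.card {T : Finpartition (dentedHexagon N U L V) //
    IsTiling T ∧ ∀ k : ℕ, diagLozenge k ∈ T.parts → k ∈ B}

/-! ## The quantities in the product formula -/

/-- The product of `b - a` over all `(a, b) ∈ A × B` with `a < b`. -/
def P (A B : Finset ℕ) : ℚ :=
  ∏ p ∈ (A ×ˢ B).filter (fun p => p.1 < p.2), ((p.2 : ℚ) - (p.1 : ℚ))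

/-- `2! · 3! ⋯ (n - 1)!`. -/
def superfact (n : ℕ) : ℚ := ∏ i ∈ Finset.Ico 2 n, (Nat.factorial i : ℚ)

/-- The elements of `U` that are not in `L`, written `U̅` when `L` is understood. -/
def bar (U L : Finset ℕ) : Finset ℕ := U \ (U ∩ L)

/-- `P(U̅, U̅) P(L̅, L̅) / ((2! ⋯ (|U| - 1)!) (2! ⋯ (|L| - 1)!))`. -/
def prefactor (U L : Finset ℕ) : ℚ :=
  P (bar U L) (bar U L) * P (bar L U) (bar L U) / (superfact U.card * superfact L.card)

/-- The sum over all `V' ⊆ B` with `|V'| = |V|` of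
`P(U̅ ∪ L̅, X) P(X, U̅ ∪ L̅) P(X, X)²`, where `X = ((U ∩ L) \ V) ∪ V'`. -/
def positionSum (U L V B : Finset ℕ) : ℚ :=
  ∑ V' ∈ B.powersetCard V.card,
    let X := ((U ∩ L) \ V) ∪ V'
    let D := bar U L ∪ bar L U
    P D X * P X D * P X X ^ 2

/-- The upper set after shuffling along `S`; the lower one is `shuffle L U S`. -/
def shuffle (U L S : Finset ℕ) : Finset ℕ := (U \ S) ∪ (L ∩ S)

end Lozenge

/-! Cut the dented hexagon along its diagonal. Only vertical lozenges cross the cut. Once the set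
`W` of their positions is fixed, a tiling is a pair of independent tilings of two half hexagons: the
upper one with dents `(U \ V) ∪ W` and, after a reflection, the lower one with dents `(L \ V) ∪ W`
(`card_cut_eq_sum`, `card_pms_image`).

A half hexagon with `d` rows and dent set `A` has `P A A / superfact d` tilings if `|A| = d`, and
none otherwise (`card_pms_dentedPart`). The proof is by induction on the number of rows. The
vertical lozenges leaving the lowest row upwards sit at a set of positions. The row has exactly one
tiling if these positions interlace with `A`, and none otherwise (`card_pms_strip_of_interlacing`,
`interlacing_of_card_pms_strip_ne_zero`). The count is therefore a sum over interlacing sequences.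
The Vandermonde quotient, written as the determinant of the binomials `a i` choose `j`, satisfies
the same recursion by multilinearity (`sum_binomDet`).

For both halves the condition on the number of dents reads `|W| = |V|`, which is the first claim.
For such `W` the dent sets are the disjoint unions of `bar U L`, respectively `bar L U`, with one
common set `X`. Since `P` is multiplicative in each argument, the factors free of `X` form the
prefactor and the others form the summand of `positionSum` (`P_sdiff_union`). That sum depends on
`U` and `L` only through `U ∪ L` and `U ∩ L`, both fixed by shuffling. It is positive when `|V| ≤
|B|`, so it cancels from the ratio. -/

namespace Lozenge

open Finset

/-! ## Determinants of binomial coefficients -/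

theorem superfact_succ (n : ℕ) : superfact (n + 1) = superfact n * n.factorial := by
  unfold superfact
  rcases Nat.lt_or_ge n 2 with h | h
  · interval_cases n <;> simp
  · rw [Finset.prod_Ico_succ_top h]

theorem superfact_pos (n : ℕ) : 0 < superfact n :=
  Finset.prod_pos fun i _ => by exact_mod_cast i.factorial_pos

theorem superfact_eq_prod (n : ℕ) : superfact n = ∏ j : Fin n, ((j : ℕ).factorial : ℚ) := by
  induction n with
  | zero => simp [superfact]
  | succ n ih => rw [superfact_succ, ih, Fin.prod_univ_castSucc]; simp

/-- The determinant of the binomial coefficients `a i` choose `j`. -/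
def binomDet {n : ℕ} (a : Fin n → ℕ) : ℚ :=
  (Matrix.of fun i j : Fin n => ((a i).choose j : ℚ)).det

/-- Multiplying column `j` by `j!` turns the binomials into falling factorials. These are monic
polynomials of degree `j` in `a i`, so the determinant equals that of the monomials. -/
theorem binomDet_mul_superfact {n : ℕ} (a : Fin n → ℕ) :
    binomDet a * superfact n = (Matrix.vandermonde fun i => (a i : ℚ)).det := by
  rw [Matrix.det_eval_matrixOfPolynomials_eq_det_vandermonde _ (fun i => descPochhammer ℚ i)
    (fun i => descPochhammer_natDegree ℚ i) (fun i => monic_descPochhammer ℚ i),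
    superfact_eq_prod, mul_comm, binomDet, ← Matrix.det_mul_row]
  congr 1
  ext i j
  simp only [Matrix.of_apply]
  rw [descPochhammer_eval_eq_descFactorial, Nat.descFactorial_eq_factorial_mul_choose]
  push_cast
  ring

theorem vandermonde_det_eq_P {n : ℕ} {a : Fin n → ℕ} (ha : StrictMono a) :
    (Matrix.vandermonde fun i => (a i : ℚ)).det = P (univ.image a) (univ.image a) := by
  rw [Matrix.det_vandermonde, P, Finset.prod_sigma']
  refine Finset.prod_bij (fun x _ => (a x.1, a x.2)) ?_ ?_ ?_ ?_
  · rintro ⟨i, j⟩ h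
    simp only [mem_sigma, mem_univ, mem_Ioi, true_and] at h
    simp [ha h]
  · rintro ⟨i, j⟩ _ ⟨i', j'⟩ _ h
    simp only [Prod.mk.injEq, ha.injective.eq_iff] at h
    simp [h.1, h.2]
  · rintro ⟨x, y⟩ h
    simp only [mem_filter, mem_product, mem_image, mem_univ, true_and] at h
    obtain ⟨⟨⟨i, rfl⟩, ⟨j, rfl⟩⟩, h⟩ := h
    exact ⟨⟨i, j⟩, by simpa using ha.lt_iff_lt.1 h, rfl⟩
  · intros; rfl

theorem binomDet_eq {n : ℕ} {a : Fin n → ℕ} (ha : StrictMono a) :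
    binomDet a = P (univ.image a) (univ.image a) / superfact n := by
  rw [eq_div_iff (superfact_pos n).ne', binomDet_mul_superfact, vandermonde_det_eq_P ha]

theorem sum_Ico_choose_cast {x y : ℕ} (h : x ≤ y) (j : ℕ) :
    ∑ k ∈ Ico x y, (k.choose j : ℚ) = (y.choose (j + 1) : ℚ) - x.choose (j + 1) := by
  induction y, h using Nat.le_induction with
  | base => simp
  | succ y h ih =>
    rw [Finset.sum_Ico_succ_top h, ih, Nat.choose_succ_succ]
    push_cast
    ring

/-- Summing the binomial determinant over all sequences interlacing with `a`. -/
theorem sum_binomDet {n : ℕ} {a : Fin (n + 1) → ℕ} (ha : StrictMono a) :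
    ∑ w ∈ Fintype.piFinset fun i : Fin n => Ico (a i.castSucc) (a i.succ), binomDet w =
      binomDet a := by
  -- Each row but the first has its predecessor subtracted. As `x` choose `0` is `1`, column `0`
  -- becomes `(1, 0, …, 0)` and the determinant reduces to a single minor.
  let B : Matrix (Fin (n + 1)) (Fin (n + 1)) ℚ := Matrix.of fun i j =>
    Fin.cases ((a 0).choose j : ℚ)
      (fun i => ((a i.succ).choose j : ℚ) - (a i.castSucc).choose j) i
  have hB : binomDet a = B.det := by
    refine Matrix.det_eq_of_forall_row_eq_smul_add_pred (fun _ => 1) ?_ ?_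
    · intro j; simp [B]
    · intro i j; simp [B]
  rw [hB, Matrix.det_succ_column_zero, Fin.sum_univ_succ]
  have h0 : ∀ i : Fin n, B i.succ 0 = 0 := by intro i; simp [B]
  have h00 : B 0 0 = 1 := by simp [B]
  simp only [h0, h00, mul_zero, zero_mul, Finset.sum_const_zero, add_zero, Fin.val_zero, pow_zero,
    one_mul]
  -- By the telescoping identity `sum_Ico_choose_cast`, row `i` of the minor is the sum of the rows
  -- `(k choose j)` over `a i ≤ k < a (i + 1)`. Multilinearity expands this into a sum over
  -- interlacing sequences.
  have := (Matrix.detRowAlternating (R := ℚ) (n := Fin n)).toMultilinearMap.map_sum_finset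
    (fun (_ : Fin n) (k : ℕ) => fun j : Fin n => (k.choose j : ℚ))
    (fun i : Fin n => Ico (a i.castSucc) (a i.succ))
  refine this.symm.trans ?_
  change Matrix.det _ = _
  congr 1
  ext i j
  simp only [Finset.sum_apply, Matrix.submatrix_apply, Fin.zero_succAbove]
  rw [sum_Ico_choose_cast (ha (Fin.castSucc_lt_succ)).le]
  simp [B]

/-! ## Perfect matchings of a region -/

section Matchings

variable {α β ι : Type*}

/-- `M` partitions the region `R` into blocks from `E`. -/
def IsPM (E : Set (Finset α)) (R : Finset α) (M : Finset (Finset α)) : Prop :=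
  (∀ b ∈ M, b ∈ E ∧ b ⊆ R) ∧ ∀ x ∈ R, ∃! b, b ∈ M ∧ x ∈ b

open Classical in
/-- The set of all partitions of `R` into blocks from `E`. -/
noncomputable def pms (E : Set (Finset α)) (R : Finset α) : Finset (Finset (Finset α)) :=
  R.powerset.powerset.filter (IsPM E R)

theorem mem_pms {E : Set (Finset α)} {R : Finset α} {M : Finset (Finset α)} :
    M ∈ pms E R ↔ IsPM E R M := by
  classical
  simp only [pms, mem_filter, mem_powerset, and_iff_right_iff_imp]
  intro h b hb
  exact mem_powerset.2 (h.1 b hb).2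

theorem IsPM.eq_of_mem {E : Set (Finset α)} {R : Finset α} {M : Finset (Finset α)}
    (h : IsPM E R M) {b c : Finset α} {x : α} (hb : b ∈ M) (hc : c ∈ M) (hxb : x ∈ b)
    (hxc : x ∈ c) : b = c :=
  (h.2 x ((h.1 b hb).2 hxb)).unique ⟨hb, hxb⟩ ⟨hc, hxc⟩

variable [DecidableEq α]

open Classical in
-- The type of a `Finpartition` depends on its region. Plain sets of blocks allow regions to be cut
-- and rewritten without transport. A `Finpartition` has no empty block, hence the condition on `E`.
theorem card_finpartition_eq {E : Set (Finset α)} (hE : ∅ ∉ E) (R : Finset α)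
    (Q : Finset (Finset α) → Prop) :
    Nat.card {T : Finpartition R // (∀ b ∈ T.parts, b ∈ E) ∧ Q T.parts} =
      ((pms E R).filter Q).card := by
  rw [← Nat.card_eq_finsetCard]
  have h : ∀ M : (pms E R).filter Q, IsPM E R M.1 ∧ Q M.1 := fun M => by
    simpa only [mem_filter, mem_pms] using M.2
  exact Nat.card_congr
    { toFun := fun T => ⟨T.1.parts, mem_filter.2 ⟨mem_pms.2 ⟨fun b hb => ⟨T.2.1 b hb, T.1.le hb⟩,
        fun x hx => T.1.existsUnique_mem hx⟩, T.2.2⟩⟩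
      invFun := fun M => ⟨Finpartition.ofExistsUnique M.1 (fun p hp => ((h M).1.1 p hp).2)
        (fun p hp => (h M).1.2 p hp) (fun h' => hE ((h M).1.1 _ h').1),
        fun b hb => ((h M).1.1 b hb).1, (h M).2⟩
      left_inv := fun T => Subtype.ext (Finpartition.ext rfl)
      right_inv := fun M => rfl }

theorem isPM_parts {E : Set (Finset α)} {R : Finset α} (T : Finpartition R)
    (hT : ∀ b ∈ T.parts, b ∈ E) : IsPM E R T.parts :=
  ⟨fun b hb => ⟨hT b hb, T.le hb⟩, fun _ hx => T.existsUnique_mem hx⟩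

open Classical in
/-- If all blocks crossing between `R₁` and `R₂` are of the form `{x k, y k}`, then the partitions
of `R₁ ∪ R₂` whose crossing blocks are given by `W` are pairs of partitions of `R₁ \ x(W)` and
`R₂ \ y(W)`. -/
theorem card_filter_crossing_eq {E : Set (Finset α)} {R₁ R₂ : Finset α} (hd : Disjoint R₁ R₂)
    {x y : ι → α} (hE : ∅ ∉ E)
    (hxy : ∀ k, {x k, y k} ∈ E) (hx : ∀ k, x k ∉ R₂) (hy : ∀ k, y k ∉ R₁)
    (hxi : Function.Injective x) (hyi : Function.Injective y)
    (hc : ∀ b ∈ E, b ⊆ R₁ ∪ R₂ → b ⊆ R₁ ∨ b ⊆ R₂ ∨ ∃ k, b = {x k, y k})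
    {W : Finset ι} (hW₁ : ∀ k ∈ W, x k ∈ R₁) (hW₂ : ∀ k ∈ W, y k ∈ R₂) :
    ((pms E (R₁ ∪ R₂)).filter fun M => ∀ k, {x k, y k} ∈ M ↔ k ∈ W).card =
      (pms E (R₁ \ W.image x)).card * (pms E (R₂ \ W.image y)).card := by
  rw [← Finset.card_product]
  have hne : ∀ b ∈ E, b.Nonempty := fun b hb => by
    rw [Finset.nonempty_iff_ne_empty]; rintro rfl; exact hE hb
  have hdl := Finset.disjoint_left.1 hd
  have hnot : ∀ b ∈ E, b ⊆ R₁ → b ⊆ R₂ → False := fun b hb h1 h2 => by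
    obtain ⟨z, hz⟩ := hne b hb
    exact hdl (h1 hz) (h2 hz)
  have hk1 : ∀ k, ¬ ({x k, y k} : Finset α) ⊆ R₁ := fun k h => hy k (h (by simp))
  have hk2 : ∀ k, ¬ ({x k, y k} : Finset α) ⊆ R₂ := fun k h => hx k (h (by simp))
  -- Nothing prevents `x k = y l` in general. For `k ∈ W` it is impossible, since `x k` lies in `R₁`
  -- and `y l` does not.
  have hinj : ∀ k l, ({x k, y k} : Finset α) = {x l, y l} → k ∈ W → k = l := by
    intro k l h hk
    have h1 : x k ∈ ({x l, y l} : Finset α) := by rw [← h]; simp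
    simp only [mem_insert, mem_singleton] at h1
    rcases h1 with h1 | h1
    · exact hxi h1
    · exact absurd (hW₁ k hk) (h1 ▸ hy l)
  -- A partition is sent to its blocks on either side of the cut. The inverse adds back the crossing
  -- blocks, which `W` determines.
  refine Finset.card_nbij' (fun M => (M.filter (· ⊆ R₁), M.filter (· ⊆ R₂)))
    (fun p => p.1 ∪ p.2 ∪ W.image fun k => {x k, y k}) ?_ ?_ ?_ ?_
  · intro M hM
    simp only [coe_filter, Set.mem_ofPred_eq, mem_pms] at hM
    obtain ⟨hM, hMW⟩ := hM
    simp only [coe_product, Set.mem_prod, mem_coe, mem_pms]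
    constructor
    · refine ⟨fun b hb => ?_, fun z hz => ?_⟩
      · rw [mem_filter] at hb
        refine ⟨(hM.1 b hb.1).1, fun z hz => ?_⟩
        rw [mem_sdiff]
        refine ⟨hb.2 hz, fun h => ?_⟩
        obtain ⟨k, hk, rfl⟩ := mem_image.1 h
        have := hM.eq_of_mem hb.1 ((hMW k).2 hk) hz (by simp)
        exact hk1 k (this ▸ hb.2)
      · rw [mem_sdiff] at hz
        obtain ⟨b, ⟨hb, hzb⟩, hu⟩ := hM.2 z (mem_union_left _ hz.1)
        refine ⟨b, ⟨?_, hzb⟩, fun c hc => hu c ⟨(mem_filter.1 hc.1).1, hc.2⟩⟩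
        refine mem_filter.2 ⟨hb, ?_⟩
        rcases hc b (hM.1 b hb).1 (hM.1 b hb).2 with h | h | ⟨k, rfl⟩
        · exact h
        · exact absurd (h hzb) (hdl hz.1)
        · exfalso
          have hk := (hMW k).1 hb
          simp only [mem_insert, mem_singleton] at hzb
          rcases hzb with rfl | rfl
          · exact hz.2 (mem_image_of_mem _ hk)
          · exact hy k hz.1
    · refine ⟨fun b hb => ?_, fun z hz => ?_⟩
      · rw [mem_filter] at hb
        refine ⟨(hM.1 b hb.1).1, fun z hz => ?_⟩
        rw [mem_sdiff]
        refine ⟨hb.2 hz, fun h => ?_⟩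
        obtain ⟨k, hk, rfl⟩ := mem_image.1 h
        have := hM.eq_of_mem hb.1 ((hMW k).2 hk) hz (by simp)
        exact hk2 k (this ▸ hb.2)
      · rw [mem_sdiff] at hz
        obtain ⟨b, ⟨hb, hzb⟩, hu⟩ := hM.2 z (mem_union_right _ hz.1)
        refine ⟨b, ⟨?_, hzb⟩, fun c hc => hu c ⟨(mem_filter.1 hc.1).1, hc.2⟩⟩
        refine mem_filter.2 ⟨hb, ?_⟩
        rcases hc b (hM.1 b hb).1 (hM.1 b hb).2 with h | h | ⟨k, rfl⟩
        · exact absurd hz.1 (hdl (h hzb))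
        · exact h
        · exfalso
          have hk := (hMW k).1 hb
          simp only [mem_insert, mem_singleton] at hzb
          rcases hzb with rfl | rfl
          · exact hx k hz.1
          · exact hz.2 (mem_image_of_mem _ hk)
  · rintro ⟨M₁, M₂⟩ h
    simp only [coe_product, Set.mem_prod, mem_coe, mem_pms] at h
    obtain ⟨h1, h2⟩ := h
    have s1 : ∀ b ∈ M₁, b ⊆ R₁ := fun b hb => (h1.1 b hb).2.trans sdiff_subset
    have s2 : ∀ b ∈ M₂, b ⊆ R₂ := fun b hb => (h2.1 b hb).2.trans sdiff_subset
    simp only [coe_filter, Set.mem_ofPred_eq, mem_pms]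
    refine ⟨⟨fun b hb => ?_, fun z hz => ?_⟩, fun k => ?_⟩
    · simp only [mem_union, mem_image] at hb
      rcases hb with (hb | hb) | ⟨k, hk, rfl⟩
      · exact ⟨(h1.1 b hb).1, (s1 b hb).trans subset_union_left⟩
      · exact ⟨(h2.1 b hb).1, (s2 b hb).trans subset_union_right⟩
      · refine ⟨hxy k, ?_⟩
        rw [insert_subset_iff, singleton_subset_iff]
        exact ⟨mem_union_left _ (hW₁ k hk), mem_union_right _ (hW₂ k hk)⟩
    · simp only [mem_union, mem_image]
      by_cases hzx : z ∈ W.image x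
      · obtain ⟨k, hk, rfl⟩ := mem_image.1 hzx
        refine ⟨{x k, y k}, ⟨Or.inr ⟨k, hk, rfl⟩, by simp⟩, ?_⟩
        rintro b ⟨(hb | hb) | ⟨l, hl, rfl⟩, hxb⟩
        · exact absurd hzx (mem_sdiff.1 ((h1.1 b hb).2 hxb)).2
        · exact absurd (s2 b hb hxb) (hx k)
        · simp only [mem_insert, mem_singleton] at hxb
          rcases hxb with hxb | hxb
          · rw [hxi hxb]
          · exact absurd (hW₁ k hk) (hxb ▸ hy l)
      by_cases hzy : z ∈ W.image y
      · obtain ⟨k, hk, rfl⟩ := mem_image.1 hzy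
        refine ⟨{x k, y k}, ⟨Or.inr ⟨k, hk, rfl⟩, by simp⟩, ?_⟩
        rintro b ⟨(hb | hb) | ⟨l, hl, rfl⟩, hxb⟩
        · exact absurd (s1 b hb hxb) (hy k)
        · exact absurd hzy (mem_sdiff.1 ((h2.1 b hb).2 hxb)).2
        · simp only [mem_insert, mem_singleton] at hxb
          rcases hxb with hxb | hxb
          · exact absurd (hW₂ k hk) (hxb ▸ hx l)
          · rw [hyi hxb]
      have hW : ∀ b, (∃ a ∈ W, ({x a, y a} : Finset α) = b) → z ∉ b := by
        rintro b ⟨k, hk, rfl⟩ h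
        simp only [mem_insert, mem_singleton] at h
        rcases h with rfl | rfl
        · exact hzx (mem_image_of_mem _ hk)
        · exact hzy (mem_image_of_mem _ hk)
      rcases mem_union.1 hz with hz | hz
      · obtain ⟨b, ⟨hb, hzb⟩, hu⟩ := h1.2 z (mem_sdiff.2 ⟨hz, hzx⟩)
        refine ⟨b, ⟨Or.inl (Or.inl hb), hzb⟩, ?_⟩
        rintro c ⟨(hc | hc) | hc, hzc⟩
        · exact hu c ⟨hc, hzc⟩
        · exact absurd (s2 c hc hzc) (hdl hz)
        · exact absurd hzc (hW c hc)
      · obtain ⟨b, ⟨hb, hzb⟩, hu⟩ := h2.2 z (mem_sdiff.2 ⟨hz, hzy⟩)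
        refine ⟨b, ⟨Or.inl (Or.inr hb), hzb⟩, ?_⟩
        rintro c ⟨(hc | hc) | hc, hzc⟩
        · exact absurd hz (hdl (s1 c hc hzc))
        · exact hu c ⟨hc, hzc⟩
        · exact absurd hzc (hW c hc)
    · simp only [mem_union, mem_image]
      constructor
      · rintro ((h | h) | ⟨l, hl, h⟩)
        · exact absurd (s1 _ h) (hk1 k)
        · exact absurd (s2 _ h) (hk2 k)
        · rw [← hinj l k h hl]; exact hl
      · exact fun h => Or.inr ⟨k, h, rfl⟩
  · intro M hM
    simp only [coe_filter, Set.mem_ofPred_eq, mem_pms] at hM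
    obtain ⟨hM, hMW⟩ := hM
    ext b
    simp only [mem_union, mem_filter, mem_image]
    constructor
    · rintro ((h | h) | ⟨k, hk, rfl⟩)
      · exact h.1
      · exact h.1
      · exact (hMW k).2 hk
    · intro hb
      rcases hc b (hM.1 b hb).1 (hM.1 b hb).2 with h | h | ⟨k, rfl⟩
      · exact Or.inl (Or.inl ⟨hb, h⟩)
      · exact Or.inl (Or.inr ⟨hb, h⟩)
      · exact Or.inr ⟨k, (hMW k).1 hb, rfl⟩
  · rintro ⟨M₁, M₂⟩ h
    simp only [coe_product, Set.mem_prod, mem_coe, mem_pms] at h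
    obtain ⟨h1, h2⟩ := h
    have s1 : ∀ b ∈ M₁, b ⊆ R₁ := fun b hb => (h1.1 b hb).2.trans sdiff_subset
    have s2 : ∀ b ∈ M₂, b ⊆ R₂ := fun b hb => (h2.1 b hb).2.trans sdiff_subset
    refine Prod.ext ?_ ?_
    · ext b
      simp only [mem_filter, mem_union, mem_image]
      constructor
      · rintro ⟨(h | h) | ⟨k, hk, rfl⟩, hb⟩
        · exact h
        · exact (hnot b (h2.1 b h).1 hb (s2 b h)).elim
        · exact absurd hb (hk1 k)
      · exact fun h => ⟨Or.inl (Or.inl h), s1 b h⟩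
    · ext b
      simp only [mem_filter, mem_union, mem_image]
      constructor
      · rintro ⟨(h | h) | ⟨k, hk, rfl⟩, hb⟩
        · exact (hnot b (h1.1 b h).1 (s1 b h) hb).elim
        · exact h
        · exact absurd hb (hk2 k)
      · exact fun h => ⟨Or.inl (Or.inr h), s2 b h⟩

open Classical in
/-- Counting partitions of `R₁ ∪ R₂` with a prescribed set of allowed crossing blocks. -/
theorem card_crossing_eq_sum [DecidableEq ι] {E : Set (Finset α)} {R₁ R₂ : Finset α} (hd : Disjoint R₁ R₂)
    {x y : ι → α} (hE : ∅ ∉ E)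
    (hxy : ∀ k, {x k, y k} ∈ E) (hx : ∀ k, x k ∉ R₂) (hy : ∀ k, y k ∉ R₁)
    (hxi : Function.Injective x) (hyi : Function.Injective y)
    (hc : ∀ b ∈ E, b ⊆ R₁ ∪ R₂ → b ⊆ R₁ ∨ b ⊆ R₂ ∨ ∃ k, b = {x k, y k})
    {K : Finset ι} (hK : ∀ k, k ∈ K ↔ x k ∈ R₁ ∧ y k ∈ R₂) (B : Finset ι) :
    ((pms E (R₁ ∪ R₂)).filter fun M => ∀ k, {x k, y k} ∈ M → k ∈ B).card =
      ∑ W ∈ (K ∩ B).powerset,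
        (pms E (R₁ \ W.image x)).card * (pms E (R₂ \ W.image y)).card := by
  have hKM : ∀ M ∈ pms E (R₁ ∪ R₂), ∀ k, {x k, y k} ∈ M → k ∈ K := by
    intro M hM k hk
    have := ((mem_pms.1 hM).1 _ hk).2
    rw [insert_subset_iff, singleton_subset_iff] at this
    rw [hK]
    exact ⟨(mem_union.1 this.1).resolve_right (hx k), (mem_union.1 this.2).resolve_left (hy k)⟩
  -- The partitions are grouped by the exact set of positions of their crossing blocks.
  rw [Finset.card_eq_sum_card_fiberwise (f := fun M => K.filter fun k => {x k, y k} ∈ M)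
    (t := (K ∩ B).powerset)]
  · refine Finset.sum_congr rfl fun W hW => ?_
    rw [mem_powerset] at hW
    rw [← card_filter_crossing_eq hd hE hxy hx hy hxi hyi hc
      (fun k hk => ((hK k).1 (mem_inter.1 (hW hk)).1).1)
      (fun k hk => ((hK k).1 (mem_inter.1 (hW hk)).1).2)]
    congr 1
    ext M
    simp only [mem_filter]
    constructor
    · rintro ⟨⟨hM, -⟩, rfl⟩
      refine ⟨hM, fun k => ?_⟩
      rw [mem_filter]
      exact ⟨fun h => ⟨hKM M hM k h, h⟩, fun h => h.2⟩
    · rintro ⟨hM, h⟩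
      refine ⟨⟨hM, fun k hk => (mem_inter.1 (hW ((h k).1 hk))).2⟩, ?_⟩
      ext k
      rw [mem_filter, h]
      exact ⟨fun h => h.2, fun h => ⟨(mem_inter.1 (hW h)).1, h⟩⟩
  · intro M hM
    rw [mem_coe, mem_filter] at hM
    simp only [coe_powerset, Set.mem_preimage, Set.mem_powerset_iff]
    intro k hk
    rw [mem_coe, mem_filter] at hk
    exact mem_coe.2 (mem_inter.2 ⟨hk.1, hM.2 k hk.2⟩)

/-- Transport of partitions along an equivalence that preserves the admissible blocks. -/
theorem card_pms_image [DecidableEq β] {E : Set (Finset α)} {E' : Set (Finset β)} (e : α ≃ β)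
    (he : ∀ b, b.image e ∈ E' ↔ b ∈ E) (R : Finset α) :
    (pms E' (R.image e)).card = (pms E R).card := by
  classical
  have hi : Function.Injective (Finset.image e) := Finset.image_injective e.injective
  have hs : Function.Surjective (Finset.image e) := fun b => ⟨b.image e.symm, by
    rw [Finset.image_image]; simp⟩
  have key : ∀ M, IsPM E' (R.image e) (M.image (Finset.image e)) ↔ IsPM E R M := by
    intro M
    simp only [IsPM, forall_mem_image, he, Finset.image_subset_image_iff e.injective]
    refine and_congr Iff.rfl (forall₂_congr fun x hx => ?_)
    constructor
    · rintro ⟨b, ⟨hb, hxb⟩, hu⟩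
      obtain ⟨c, hc, rfl⟩ := mem_image.1 hb
      refine ⟨c, ⟨hc, by simpa using hxb⟩, fun d hd => hi (hu _ ⟨mem_image_of_mem _ hd.1, ?_⟩)⟩
      exact mem_image_of_mem _ hd.2
    · rintro ⟨b, ⟨hb, hxb⟩, hu⟩
      refine ⟨b.image e, ⟨mem_image_of_mem _ hb, mem_image_of_mem _ hxb⟩, ?_⟩
      rintro d ⟨hd, hxd⟩
      obtain ⟨c, hc, rfl⟩ := mem_image.1 hd
      rw [hu c ⟨hc, by simpa using hxd⟩]
  symm
  refine Finset.card_bij (fun M _ => M.image (Finset.image e)) ?_ ?_ ?_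
  · intro M hM
    rw [mem_pms] at hM ⊢
    exact (key M).2 hM
  · intro M _ M' _ h
    exact Finset.image_injective hi h
  · intro M hM
    have hM' : M = (M.preimage _ hi.injOn).image (Finset.image e) := by
      rw [Finset.image_preimage, Finset.filter_true_of_mem]
      intro b _; exact hs b
    refine ⟨M.preimage _ hi.injOn, ?_, hM'.symm⟩
    rw [mem_pms] at hM ⊢
    rw [hM'] at hM
    exact (key _).1 hM

end Matchings

/-! ## Lozenges and rows of triangles -/

@[simp] theorem up_inj {i j i' j' : ℤ} : up i j = up i' j' ↔ i = i' ∧ j = j' := by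
  simp [up]

@[simp] theorem down_inj {i j i' j' : ℤ} : down i j = down i' j' ↔ i = i' ∧ j = j' := by
  simp [down]

@[simp] theorem up_ne_down {i j i' j' : ℤ} : up i j ≠ down i' j' := by simp [up, down]

@[simp] theorem down_ne_up {i j i' j' : ℤ} : down i j ≠ up i' j' := by simp [up, down]

theorem exists_eq_up_or_down (t : Tri) : ∃ i j, t = up i j ∨ t = down i j := by
  obtain ⟨i, j, b⟩ := t
  cases b
  · exact ⟨i, j, Or.inr rfl⟩
  · exact ⟨i, j, Or.inl rfl⟩

theorem card_vertices (t : Tri) : (vertices t).card = 3 := by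
  obtain ⟨i, j, b⟩ := t
  cases b <;> simp [vertices]

theorem adjacent_up_down {i j i' j' : ℤ} :
    Adjacent (up i j) (down i' j') ↔
      (i' = i ∧ j' = j) ∨ (i' = i - 1 ∧ j' = j) ∨ (i' = i ∧ j' = j - 1) := by
  constructor
  · intro h
    obtain ⟨⟨p, q⟩, ⟨r, s⟩, hne, h⟩ := Finset.card_eq_two.1 h
    have h1 : (p, q) ∈ vertices (up i j) ∩ vertices (down i' j') := by rw [h]; simp
    have h2 : (r, s) ∈ vertices (up i j) ∩ vertices (down i' j') := by rw [h]; simp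
    simp only [vertices, up, down, mem_inter, mem_insert, mem_singleton, Prod.mk.injEq] at h1 h2
    simp only [ne_eq, Prod.mk.injEq] at hne
    omega
  · have key : ∀ p q : ℤ × ℤ, p ≠ q → vertices (up i j) ∩ vertices (down i' j') = {p, q} →
        Adjacent (up i j) (down i' j') := fun p q hpq h => by
      rw [Adjacent, h, Finset.card_pair hpq]
    rintro (⟨rfl, rfl⟩ | ⟨rfl, rfl⟩ | ⟨rfl, rfl⟩)
    · refine key (i' + 1, j') (i', j' + 1) (by simp) ?_
      ext ⟨x, y⟩
      simp only [vertices, up, down, mem_inter, mem_insert, mem_singleton, Prod.mk.injEq]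
      omega
    · refine key (i, j') (i, j' + 1) (by simp) ?_
      ext ⟨x, y⟩
      simp only [vertices, up, down, mem_inter, mem_insert, mem_singleton, Prod.mk.injEq]
      omega
    · refine key (i', j) (i' + 1, j) (by simp) ?_
      ext ⟨x, y⟩
      simp only [vertices, up, down, mem_inter, mem_insert, mem_singleton, Prod.mk.injEq]
      omega

/-- Two triangles of the same orientation with two common corners coincide, and then they share
three corners rather than two. -/
theorem not_adjacent_up_up {i j i' j' : ℤ} : ¬ Adjacent (up i j) (up i' j') := by
  intro h
  have h3 := card_vertices (up i j)
  obtain ⟨⟨p, q⟩, ⟨r, s⟩, hne, h'⟩ := Finset.card_eq_two.1 h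
  have h1 : (p, q) ∈ vertices (up i j) ∩ vertices (up i' j') := by rw [h']; simp
  have h2 : (r, s) ∈ vertices (up i j) ∩ vertices (up i' j') := by rw [h']; simp
  simp only [vertices, up, mem_inter, mem_insert, mem_singleton, Prod.mk.injEq] at h1 h2
  simp only [ne_eq, Prod.mk.injEq] at hne
  obtain ⟨rfl, rfl⟩ : i = i' ∧ j = j' := by omega
  rw [Adjacent, inter_self] at h
  omega

theorem not_adjacent_down_down {i j i' j' : ℤ} : ¬ Adjacent (down i j) (down i' j') := by
  intro h
  have h3 := card_vertices (down i j)
  obtain ⟨⟨p, q⟩, ⟨r, s⟩, hne, h'⟩ := Finset.card_eq_two.1 h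
  have h1 : (p, q) ∈ vertices (down i j) ∩ vertices (down i' j') := by rw [h']; simp
  have h2 : (r, s) ∈ vertices (down i j) ∩ vertices (down i' j') := by rw [h']; simp
  simp only [vertices, down, mem_inter, mem_insert, mem_singleton, Prod.mk.injEq] at h1 h2
  simp only [ne_eq, Prod.mk.injEq] at hne
  obtain ⟨rfl, rfl⟩ : i = i' ∧ j = j' := by omega
  rw [Adjacent, inter_self] at h
  omega

theorem isLozenge_iff {b : Finset Tri} :
    IsLozenge b ↔ ∃ i j, b = {up i j, down i j} ∨ b = {up (i + 1) j, down i j} ∨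
      b = {up i j, down i (j - 1)} := by
  have key : ∀ i j i' j', Adjacent (up i j) (down i' j') →
      ∃ p q, ({up i j, down i' j'} : Finset Tri) = {up p q, down p q} ∨
        ({up i j, down i' j'} : Finset Tri) = {up (p + 1) q, down p q} ∨
        ({up i j, down i' j'} : Finset Tri) = {up p q, down p (q - 1)} := by
    intro i j i' j' h
    rcases adjacent_up_down.1 h with ⟨rfl, rfl⟩ | ⟨rfl, rfl⟩ | ⟨rfl, rfl⟩
    · exact ⟨_, _, Or.inl rfl⟩
    · exact ⟨i - 1, j', Or.inr (Or.inl (by simp))⟩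
    · exact ⟨_, _, Or.inr (Or.inr rfl)⟩
  constructor
  · rintro ⟨s, t, h, rfl⟩
    obtain ⟨i, j, rfl | rfl⟩ := exists_eq_up_or_down s <;>
      obtain ⟨i', j', rfl | rfl⟩ := exists_eq_up_or_down t
    · exact absurd h not_adjacent_up_up
    · exact key _ _ _ _ h
    · rw [Finset.pair_comm]
      rw [Adjacent, inter_comm] at h
      exact key _ _ _ _ h
    · exact absurd h not_adjacent_down_down
  · rintro ⟨i, j, rfl | rfl | rfl⟩
    · exact ⟨_, _, adjacent_up_down.2 (by simp), rfl⟩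
    · exact ⟨_, _, adjacent_up_down.2 (by simp), rfl⟩
    · exact ⟨_, _, adjacent_up_down.2 (by simp), rfl⟩

/-- The set of all lozenges. -/
def lozenges : Set (Finset Tri) := {b | IsLozenge b}

theorem empty_notMem_lozenges : ∅ ∉ lozenges := by
  rintro ⟨s, t, -, h⟩
  exact (Finset.insert_ne_empty s {t}) h.symm

/-! ### The reflection exchanging the two sides of the diagonal. -/

/-- The reflection of the lattice across the line `j = 0`. -/
def flip : Tri → Tri
  | (i, j, true) => (i + j, -j - 1, false)
  | (i, j, false) => (i + j + 1, -j - 1, true)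

@[simp] theorem flip_up (i j : ℤ) : flip (up i j) = down (i + j) (-j - 1) := rfl

@[simp] theorem flip_down (i j : ℤ) : flip (down i j) = up (i + j + 1) (-j - 1) := rfl

theorem flip_flip : Function.Involutive flip := by
  intro t
  obtain ⟨i, j, rfl | rfl⟩ := exists_eq_up_or_down t
  · simp only [flip_up, flip_down, up_inj]; omega
  · simp only [flip_up, flip_down, down_inj]; omega

/-- The reflection `flip` as a permutation. -/
def flipEquiv : Tri ≃ Tri := flip_flip.toPerm

@[simp] theorem coe_flipEquiv : ⇑flipEquiv = flip := rfl

theorem image_flip_mem_lozenges {b : Finset Tri} : b.image flip ∈ lozenges ↔ b ∈ lozenges := by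
  have key : ∀ b ∈ lozenges, b.image flip ∈ lozenges := by
    intro b hb
    obtain ⟨i, j, rfl | rfl | rfl⟩ := isLozenge_iff.1 hb <;>
      simp only [image_insert, image_singleton, flip_up, flip_down] <;> rw [Finset.pair_comm] <;>
      refine isLozenge_iff.2 ?_
    · exact ⟨i + j, -j - 1, Or.inr (Or.inl rfl)⟩
    · exact ⟨i + j + 1, -j - 1, Or.inl (by rw [add_right_comm])⟩
    · refine ⟨i + j, -j, Or.inr (Or.inr ?_)⟩
      rw [show i + (j - 1) + 1 = i + j by ring, show -(j - 1) - 1 = -j by ring]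
  refine ⟨fun h => ?_, key b⟩
  have := key _ h
  rwa [Finset.image_image, flip_flip.comp_self, Finset.image_id] at this

theorem mem_image_flip {t : Tri} {R : Finset Tri} : t ∈ R.image flip ↔ flip t ∈ R := by
  constructor
  · rintro h
    obtain ⟨s, hs, rfl⟩ := mem_image.1 h
    rwa [flip_flip]
  · exact fun h => mem_image.2 ⟨_, h, flip_flip t⟩

/-! ## Cutting a region along a horizontal line -/

section Cut

variable {R₁ R₂ : Finset Tri} {c : ℤ}

/-- Of the three kinds of lozenge only the vertical one meets two rows. `h₃` makes the column of a
crossing lozenge a natural number. -/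
theorem crossing_cases (h₁ : ∀ t ∈ R₁, c ≤ t.2.1) (h₂ : ∀ t ∈ R₂, t.2.1 < c)
    (h₃ : ∀ i, up i c ∈ R₁ → 0 ≤ i) :
    ∀ b ∈ lozenges, b ⊆ R₁ ∪ R₂ →
      b ⊆ R₁ ∨ b ⊆ R₂ ∨ ∃ k : ℕ, b = {up k c, down k (c - 1)} := by
  intro b hb hbR
  have side : ∀ t, t ∈ R₁ ∪ R₂ → (t ∈ R₁ ∧ c ≤ t.2.1) ∨ (t ∈ R₂ ∧ t.2.1 < c) := by
    intro t ht
    rcases mem_union.1 ht with h | h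
    · exact Or.inl ⟨h, h₁ t h⟩
    · exact Or.inr ⟨h, h₂ t h⟩
  obtain ⟨i, j, rfl | rfl | rfl⟩ := isLozenge_iff.1 hb <;>
    simp only [insert_subset_iff, singleton_subset_iff] at hbR ⊢
  · rcases side _ hbR.1 with h | h <;> rcases side _ hbR.2 with h' | h' <;>
      simp only [up, down] at h h'
    · exact Or.inl ⟨h.1, h'.1⟩
    · omega
    · omega
    · exact Or.inr (Or.inl ⟨h.1, h'.1⟩)
  · rcases side _ hbR.1 with h | h <;> rcases side _ hbR.2 with h' | h' <;>
      simp only [up, down] at h h'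
    · exact Or.inl ⟨h.1, h'.1⟩
    · omega
    · omega
    · exact Or.inr (Or.inl ⟨h.1, h'.1⟩)
  · rcases side _ hbR.1 with h | h <;> rcases side _ hbR.2 with h' | h'
    · exact Or.inl ⟨h.1, h'.1⟩
    · simp only [up, down] at h h'
      obtain rfl : j = c := by omega
      obtain ⟨k, rfl⟩ := Int.eq_ofNat_of_zero_le (h₃ i h.1)
      exact Or.inr (Or.inr ⟨k, rfl⟩)
    · simp only [up, down] at h h'; omega
    · exact Or.inr (Or.inl ⟨h.1, h'.1⟩)

theorem disjoint_of_rows (h₁ : ∀ t ∈ R₁, c ≤ t.2.1) (h₂ : ∀ t ∈ R₂, t.2.1 < c) :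
    Disjoint R₁ R₂ :=
  Finset.disjoint_left.2 fun t h h' => absurd (h₁ t h) (not_le.2 (h₂ t h'))

theorem vertical_mem_lozenges (k c : ℤ) : {up k c, down k (c - 1)} ∈ lozenges :=
  isLozenge_iff.2 ⟨k, c, Or.inr (Or.inr rfl)⟩

open Classical in
theorem card_filter_cut_eq (h₁ : ∀ t ∈ R₁, c ≤ t.2.1) (h₂ : ∀ t ∈ R₂, t.2.1 < c)
    (h₃ : ∀ i, up i c ∈ R₁ → 0 ≤ i) {W : Finset ℕ} (hW₁ : ∀ k ∈ W, up k c ∈ R₁)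
    (hW₂ : ∀ k ∈ W, down k (c - 1) ∈ R₂) :
    ((pms lozenges (R₁ ∪ R₂)).filter fun M =>
      ∀ k : ℕ, {up k c, down k (c - 1)} ∈ M ↔ k ∈ W).card =
      (pms lozenges (R₁ \ W.image fun k : ℕ => up k c)).card *
        (pms lozenges (R₂ \ W.image fun k : ℕ => down k (c - 1))).card :=
  card_filter_crossing_eq (x := fun k : ℕ => up k c) (y := fun k : ℕ => down k (c - 1))
    (disjoint_of_rows h₁ h₂) empty_notMem_lozenges
    (fun k => vertical_mem_lozenges k c) (fun k h => by simpa [up] using h₂ _ h)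
    (fun k h => by simpa [down] using h₁ _ h) (fun k l h => by simpa using h)
    (fun k l h => by simpa using h) (crossing_cases h₁ h₂ h₃) hW₁ hW₂

open Classical in
theorem card_cut_eq_sum (h₁ : ∀ t ∈ R₁, c ≤ t.2.1) (h₂ : ∀ t ∈ R₂, t.2.1 < c)
    (h₃ : ∀ i, up i c ∈ R₁ → 0 ≤ i) {K : Finset ℕ}
    (hK : ∀ k : ℕ, k ∈ K ↔ up k c ∈ R₁ ∧ down k (c - 1) ∈ R₂) (B : Finset ℕ) :
    ((pms lozenges (R₁ ∪ R₂)).filter fun M =>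
      ∀ k : ℕ, {up k c, down k (c - 1)} ∈ M → k ∈ B).card =
      ∑ W ∈ (K ∩ B).powerset, (pms lozenges (R₁ \ W.image fun k : ℕ => up k c)).card *
        (pms lozenges (R₂ \ W.image fun k : ℕ => down k (c - 1))).card :=
  card_crossing_eq_sum (x := fun k : ℕ => up k c) (y := fun k : ℕ => down k (c - 1))
    (disjoint_of_rows h₁ h₂) empty_notMem_lozenges
    (fun k => vertical_mem_lozenges k c) (fun k h => by simpa [up] using h₂ _ h)
    (fun k h => by simpa [down] using h₁ _ h) (fun k l h => by simpa using h)
    (fun k l h => by simpa using h) (crossing_cases h₁ h₂ h₃) hK B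

end Cut

/-! ## Tilings of a single row -/

/-- The number of elements of `A` that are at most `k`. -/
def countLE (A : Finset ℕ) (k : ℕ) : ℕ := (A.filter (· ≤ k)).card

theorem countLE_succ_of_mem {A : Finset ℕ} {k : ℕ} (h : k + 1 ∈ A) :
    countLE A (k + 1) = countLE A k + 1 := by
  have : A.filter (· ≤ k + 1) = insert (k + 1) (A.filter (· ≤ k)) := by
    ext x
    simp only [mem_filter, mem_insert]
    constructor
    · rintro ⟨hx, h'⟩
      rcases Nat.lt_or_ge k x with h'' | h''
      · left; omega
      · exact Or.inr ⟨hx, h''⟩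
    · rintro (rfl | h')
      · exact ⟨h, le_rfl⟩
      · exact ⟨h'.1, by omega⟩
  rw [countLE, this, card_insert_of_notMem (by simp), countLE]

theorem countLE_succ_of_notMem {A : Finset ℕ} {k : ℕ} (h : k + 1 ∉ A) :
    countLE A (k + 1) = countLE A k := by
  unfold countLE
  congr 1
  refine Finset.filter_congr fun x hx => ?_
  have : x ≠ k + 1 := fun h' => h (h' ▸ hx)
  omega

theorem countLE_zero {A : Finset ℕ} (h : 0 ∉ A) : countLE A 0 = 0 := by
  rw [countLE, Finset.card_eq_zero, Finset.filter_eq_empty_iff]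
  intro x hx hx'
  exact h (Nat.le_zero.1 hx' ▸ hx)

theorem countLE_of_forall_le {A : Finset ℕ} {k : ℕ} (h : ∀ x ∈ A, x ≤ k) :
    countLE A k = A.card := by
  rw [countLE, Finset.filter_true_of_mem h]

/-- The row `j` with upwards-pointing triangles at the positions in `[1, n] \ A` and
downwards-pointing triangles at the positions in `[1, n) \ W`. -/
def strip (j n : ℕ) (A W : Finset ℕ) : Finset Tri :=
  (Icc 1 n \ A).image (fun k : ℕ => up k j) ∪ (Ico 1 n \ W).image (fun k : ℕ => down k j)

section Strip

variable {j n : ℕ} {A W : Finset ℕ}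

theorem up_mem_strip {k : ℕ} {c : ℤ} :
    up k c ∈ strip j n A W ↔ c = j ∧ 1 ≤ k ∧ k ≤ n ∧ k ∉ A := by
  simp only [strip, mem_union, mem_image, mem_sdiff, mem_Icc, up_inj, down_ne_up, and_false,
    exists_false, or_false, Nat.cast_inj]
  constructor
  · rintro ⟨l, ⟨⟨h1, h2⟩, h3⟩, rfl, rfl⟩
    exact ⟨rfl, h1, h2, h3⟩
  · rintro ⟨rfl, h1, h2, h3⟩
    exact ⟨k, ⟨⟨h1, h2⟩, h3⟩, rfl, rfl⟩

theorem down_mem_strip {k : ℕ} {c : ℤ} :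
    down k c ∈ strip j n A W ↔ c = j ∧ 1 ≤ k ∧ k < n ∧ k ∉ W := by
  simp only [strip, mem_union, mem_image, mem_sdiff, mem_Ico, down_inj, up_ne_down, and_false,
    exists_false, false_or, Nat.cast_inj]
  constructor
  · rintro ⟨l, ⟨⟨h1, h2⟩, h3⟩, rfl, rfl⟩
    exact ⟨rfl, h1, h2, h3⟩
  · rintro ⟨rfl, h1, h2, h3⟩
    exact ⟨k, ⟨⟨h1, h2⟩, h3⟩, rfl, rfl⟩

theorem exists_of_mem_strip {t : Tri} (ht : t ∈ strip j n A W) :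
    ∃ k : ℕ, t = up k j ∨ t = down k j := by
  simp only [strip, mem_union, mem_image] at ht
  obtain ⟨k, -, rfl⟩ | ⟨k, -, rfl⟩ := ht
  · exact ⟨k, Or.inl rfl⟩
  · exact ⟨k, Or.inr rfl⟩

/-- The lozenge formed by an upwards-pointing triangle and its right neighbour. -/
def rightLozenge (j k : ℕ) : Finset Tri := {up k j, down k j}

/-- The lozenge formed by a downwards-pointing triangle and its right neighbour. -/
def leftLozenge (j k : ℕ) : Finset Tri := {up ((k + 1 : ℕ) : ℤ) j, down k j}

theorem rightLozenge_mem (j k : ℕ) : rightLozenge j k ∈ lozenges :=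
  isLozenge_iff.2 ⟨k, j, Or.inl rfl⟩

theorem leftLozenge_mem (j k : ℕ) : leftLozenge j k ∈ lozenges :=
  isLozenge_iff.2 ⟨k, j, Or.inr (Or.inl (by simp [leftLozenge]))⟩

@[simp] theorem up_mem_rightLozenge {k l : ℕ} : up k j ∈ rightLozenge j l ↔ k = l := by
  simp [rightLozenge]

@[simp] theorem down_mem_rightLozenge {k l : ℕ} : down k j ∈ rightLozenge j l ↔ k = l := by
  simp [rightLozenge]

@[simp] theorem up_mem_leftLozenge {k l : ℕ} : up k j ∈ leftLozenge j l ↔ k = l + 1 := by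
  simp only [leftLozenge, mem_insert, mem_singleton, up_inj, up_ne_down, or_false, and_true]
  exact Nat.cast_inj

@[simp] theorem down_mem_leftLozenge {k l : ℕ} : down k j ∈ leftLozenge j l ↔ k = l := by
  simp [leftLozenge]

theorem rightLozenge_subset {k : ℕ} :
    rightLozenge j k ⊆ strip j n A W ↔ 1 ≤ k ∧ k < n ∧ k ∉ A ∧ k ∉ W := by
  rw [rightLozenge, insert_subset_iff, singleton_subset_iff, up_mem_strip, down_mem_strip]
  constructor
  · rintro ⟨⟨-, h1, h2, h3⟩, -, h4, h5, h6⟩; exact ⟨h1, h5, h3, h6⟩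
  · rintro ⟨h1, h2, h3, h4⟩; exact ⟨⟨rfl, h1, h2.le, h3⟩, rfl, h1, h2, h4⟩

theorem leftLozenge_subset {k : ℕ} :
    leftLozenge j k ⊆ strip j n A W ↔ 1 ≤ k ∧ k < n ∧ k + 1 ∉ A ∧ k ∉ W := by
  rw [leftLozenge, insert_subset_iff, singleton_subset_iff, up_mem_strip, down_mem_strip]
  constructor
  · rintro ⟨⟨-, h1, h2, h3⟩, -, h4, h5, h6⟩; exact ⟨h4, h5, h3, h6⟩
  · rintro ⟨h1, h2, h3, h4⟩; exact ⟨⟨rfl, by omega, by omega, h3⟩, rfl, h1, h2, h4⟩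

theorem lozenge_subset_strip {b : Finset Tri} (hb : b ∈ lozenges) (hs : b ⊆ strip j n A W) :
    ∃ k, b = rightLozenge j k ∨ b = leftLozenge j k := by
  obtain ⟨i, c, rfl | rfl | rfl⟩ := isLozenge_iff.1 hb <;>
    rw [insert_subset_iff, singleton_subset_iff] at hs
  · obtain ⟨k, h | h⟩ := exists_of_mem_strip hs.1
    · obtain ⟨rfl, rfl⟩ := up_inj.1 h
      exact ⟨k, Or.inl rfl⟩
    · exact absurd h up_ne_down
  · obtain ⟨k, h | h⟩ := exists_of_mem_strip hs.2
    · exact absurd h down_ne_up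
    · obtain ⟨rfl, rfl⟩ := down_inj.1 h
      exact ⟨k, Or.inr (by simp [leftLozenge])⟩
  · obtain ⟨k, h | h⟩ := exists_of_mem_strip hs.1
    · obtain ⟨l, h' | h'⟩ := exists_of_mem_strip hs.2
      · exact absurd h' down_ne_up
      · have := (up_inj.1 h).2
        have := (down_inj.1 h').2
        omega
    · exact absurd h up_ne_down

/-- In a tiling of the row, whether the triangle `up k j` is joined to its right neighbour is
determined by the numbers of missing triangles to its left. -/
theorem IsPM.strip_state {M : Finset (Finset Tri)} (hM : IsPM lozenges (strip j n A W) M)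
    (hA : A ⊆ Icc 1 n) (hW : W ⊆ Ico 1 n) {k : ℕ} (hk : 1 ≤ k) (hkn : k ≤ n) :
    (rightLozenge j k ∈ M ∧ countLE A k = countLE W (k - 1) ∧ k ∉ W) ∨
      (rightLozenge j k ∉ M ∧ countLE A k = countLE W (k - 1) + 1) := by
  have hr : ∀ k, rightLozenge j k ∈ M → 1 ≤ k ∧ k < n ∧ k ∉ A ∧ k ∉ W := fun k h =>
    rightLozenge_subset.1 (hM.1 _ h).2
  have hl : ∀ k, leftLozenge j k ∈ M → 1 ≤ k ∧ k < n ∧ k + 1 ∉ A ∧ k ∉ W := fun k h =>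
    leftLozenge_subset.1 (hM.1 _ h).2
  have hlr : ∀ k, leftLozenge j k ∈ M → rightLozenge j k ∈ M → False := fun k h h' => by
    have := hM.eq_of_mem (x := down k j) h h' (by simp) (by simp)
    have h2 : up k j ∈ leftLozenge j k := by rw [this]; simp
    simp at h2
  have hlr' : ∀ k, leftLozenge j k ∈ M → rightLozenge j (k + 1) ∈ M → False := fun k h h' => by
    have := hM.eq_of_mem (x := up ((k + 1 : ℕ) : ℤ) j) h h' (up_mem_leftLozenge.2 rfl)
      (up_mem_rightLozenge.2 rfl)
    have h2 : down k j ∈ rightLozenge j (k + 1) := by rw [← this]; simp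
    simp at h2
  have hup : ∀ k, 1 ≤ k → k ≤ n → k ∉ A →
      rightLozenge j k ∈ M ∨ ∃ l, k = l + 1 ∧ leftLozenge j l ∈ M := by
    intro k h1 h2 h3
    obtain ⟨b, ⟨hb, hub⟩, -⟩ := hM.2 (up k j) (up_mem_strip.2 ⟨rfl, h1, h2, h3⟩)
    obtain ⟨l, rfl | rfl⟩ := lozenge_subset_strip (hM.1 b hb).1 (hM.1 b hb).2
    · rw [up_mem_rightLozenge] at hub
      subst hub; exact Or.inl hb
    · exact Or.inr ⟨l, up_mem_leftLozenge.1 hub, hb⟩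
  have hdown : ∀ k, 1 ≤ k → k < n → k ∉ W → rightLozenge j k ∈ M ∨ leftLozenge j k ∈ M := by
    intro k h1 h2 h3
    obtain ⟨b, ⟨hb, hub⟩, -⟩ := hM.2 (down k j) (down_mem_strip.2 ⟨rfl, h1, h2, h3⟩)
    obtain ⟨l, rfl | rfl⟩ := lozenge_subset_strip (hM.1 b hb).1 (hM.1 b hb).2
    · rw [down_mem_rightLozenge] at hub
      subst hub; exact Or.inl hb
    · rw [down_mem_leftLozenge] at hub
      subst hub; exact Or.inr hb
  have hA0 : countLE A 0 = 0 := countLE_zero fun h => by simpa using hA h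
  have hW0 : countLE W 0 = 0 := countLE_zero fun h => by simpa using hW h
  -- The row is read from left to right. Among the first `k` upwards and the first `k - 1` downwards
  -- triangles that are present, all are matched with each other except possibly `up k j`, which may
  -- be joined to `down k j`. So the surplus of upwards triangles, `1 - countLE A k + countLE W (k -
  -- 1)`, is `1` if the right lozenge at `k` is used and `0` otherwise.
  induction k, hk using Nat.le_induction with
  | base =>
    by_cases h1 : 1 ∈ A
    · right
      refine ⟨fun h => (hr 1 h).2.2.1 h1, ?_⟩
      rw [countLE_succ_of_mem (k := 0) h1, hA0, hW0]
    · left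
      rcases hup 1 le_rfl hkn h1 with h | ⟨l, hl1, h⟩
      · refine ⟨h, ?_, (hr 1 h).2.2.2⟩
        rw [countLE_succ_of_notMem (k := 0) h1, hA0, hW0]
      · have := (hl l h).1; omega
  | succ k hk ih =>
    obtain ⟨k, rfl⟩ := Nat.exists_eq_add_of_le' hk
    have ih := ih (by omega)
    simp only [Nat.add_sub_cancel] at ih ⊢
    have hright : rightLozenge j (k + 1 + 1) ∈ M → k + 1 + 1 ∉ W := fun h => (hr _ h).2.2.2
    have hnext : leftLozenge j (k + 1) ∉ M →
        (k + 2 ∈ A ∧ rightLozenge j (k + 2) ∉ M) ∨ (k + 2 ∉ A ∧ rightLozenge j (k + 2) ∈ M) := by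
      intro h
      by_cases hk2 : k + 2 ∈ A
      · exact Or.inl ⟨hk2, fun h' => (hr _ h').2.2.1 hk2⟩
      · refine Or.inr ⟨hk2, (hup _ (by omega) hkn hk2).resolve_right ?_⟩
        rintro ⟨l, hl, hl'⟩
        obtain rfl : l = k + 1 := by omega
        exact h hl'
    rcases ih with ⟨h1, h2, h3⟩ | ⟨h1, h2⟩
    · rw [countLE_succ_of_notMem h3, ← h2]
      rcases hnext (fun h => hlr _ h h1) with ⟨h4, h5⟩ | ⟨h4, h5⟩
      · exact Or.inr ⟨h5, countLE_succ_of_mem h4⟩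
      · exact Or.inl ⟨h5, countLE_succ_of_notMem h4, hright h5⟩
    · by_cases h3 : k + 1 ∈ W
      · rw [countLE_succ_of_mem h3, ← h2]
        rcases hnext (fun h => (hl _ h).2.2.2 h3) with ⟨h4, h5⟩ | ⟨h4, h5⟩
        · exact Or.inr ⟨h5, countLE_succ_of_mem h4⟩
        · exact Or.inl ⟨h5, countLE_succ_of_notMem h4, hright h5⟩
      · have h4 := (hdown _ (by omega) (by omega) h3).resolve_left h1
        refine Or.inr ⟨hlr' _ h4, ?_⟩
        rw [countLE_succ_of_notMem h3, countLE_succ_of_notMem (hl _ h4).2.2.1, h2]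

theorem IsPM.strip_unique {M M' : Finset (Finset Tri)} (hM : IsPM lozenges (strip j n A W) M)
    (hM' : IsPM lozenges (strip j n A W) M') (hA : A ⊆ Icc 1 n) (hW : W ⊆ Ico 1 n) : M = M' := by
  suffices key : ∀ M M', IsPM lozenges (strip j n A W) M → IsPM lozenges (strip j n A W) M' →
      M ⊆ M' from Subset.antisymm (key _ _ hM hM') (key _ _ hM' hM)
  clear hM hM' M M'
  intro M M' hM hM'
  have hright : ∀ k, rightLozenge j k ∈ M → rightLozenge j k ∈ M' := by
    intro k hk
    obtain ⟨h1, h2, -⟩ := rightLozenge_subset.1 (hM.1 _ hk).2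
    rcases hM.strip_state hA hW h1 h2.le with h | h
    · rcases hM'.strip_state hA hW h1 h2.le with h' | h'
      · exact h'.1
      · omega
    · exact absurd hk h.1
  have hright' : ∀ k, rightLozenge j k ∈ M' → rightLozenge j k ∈ M := by
    intro k hk
    obtain ⟨h1, h2, -⟩ := rightLozenge_subset.1 (hM'.1 _ hk).2
    rcases hM'.strip_state hA hW h1 h2.le with h | h
    · rcases hM.strip_state hA hW h1 h2.le with h' | h'
      · exact h'.1
      · omega
    · exact absurd hk h.1
  intro b hb
  obtain ⟨k, rfl | rfl⟩ := lozenge_subset_strip (hM.1 b hb).1 (hM.1 b hb).2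
  · exact hright k hb
  · obtain ⟨c, ⟨hc, hkc⟩, -⟩ := hM'.2 (down k j) ((hM.1 _ hb).2 (by simp))
    obtain ⟨l, rfl | rfl⟩ := lozenge_subset_strip (hM'.1 c hc).1 (hM'.1 c hc).2
    · rw [down_mem_rightLozenge] at hkc
      subst hkc
      have := hM.eq_of_mem (x := down k j) hb (hright' k hc) (by simp) (by simp)
      have h2 : up k j ∈ leftLozenge j k := by rw [this]; simp
      simp at h2
    · rw [down_mem_leftLozenge] at hkc
      subst hkc
      exact hc

/-- The inequalities are read off from the two states in `strip_state`. At `k = n` there is no right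
neighbour, so the second state holds there and gives the cardinalities. Beyond `n` the counts are
constant. -/
theorem IsPM.strip_countLE {M : Finset (Finset Tri)} (hM : IsPM lozenges (strip j n A W) M)
    (hA : A ⊆ Icc 1 n) (hW : W ⊆ Ico 1 n) (hn : 1 ≤ n) :
    (∀ k, countLE W k ≤ countLE A k ∧ (1 ≤ k → countLE A k ≤ countLE W (k - 1) + 1)) ∧
      A.card = W.card + 1 := by
  have hcard : A.card = W.card + 1 := by
    rcases hM.strip_state hA hW hn le_rfl with h | h
    · have := (rightLozenge_subset.1 (hM.1 _ h.1).2).2.1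
      omega
    · rw [countLE_of_forall_le fun x hx => (mem_Icc.1 (hA hx)).2,
        countLE_of_forall_le fun x hx => by have := mem_Ico.1 (hW hx); omega] at h
      exact h.2
  refine ⟨fun k => ?_, hcard⟩
  rcases Nat.eq_zero_or_pos k with rfl | hk
  · rw [countLE_zero fun h => by simpa using hW h]
    omega
  rcases Nat.lt_or_ge n k with hkn | hkn
  · rw [countLE_of_forall_le fun x hx => by have := mem_Ico.1 (hW hx); omega,
      countLE_of_forall_le fun x hx => by have := mem_Icc.1 (hA hx); omega,
      countLE_of_forall_le fun x hx => by have := mem_Ico.1 (hW hx); omega]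
    omega
  · obtain ⟨k, rfl⟩ := Nat.exists_eq_add_of_le' hk
    simp only [Nat.add_sub_cancel]
    have h := hM.strip_state hA hW hk hkn
    simp only [Nat.add_sub_cancel] at h
    rcases h with ⟨-, h1, h2⟩ | ⟨-, h1⟩
    · rw [countLE_succ_of_notMem h2]; omega
    · by_cases h2 : k + 1 ∈ W
      · rw [countLE_succ_of_mem h2]; omega
      · rw [countLE_succ_of_notMem h2]; omega

/-- The tiling forced by `strip_state` is written down: a present triangle `up (k + 1) j` is joined
to its right neighbour if `countLE A (k + 1) = countLE W k`, and to its left neighbour otherwise.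
The inequalities leave no third case, and the cardinalities keep the last triangle from being joined
to the right. -/
theorem exists_isPM_strip (hA : A ⊆ Icc 1 n) (hW : W ⊆ Ico 1 n)
    (h : ∀ k, countLE W k ≤ countLE A k ∧ (1 ≤ k → countLE A k ≤ countLE W (k - 1) + 1))
    (hcard : A.card = W.card + 1) : ∃ M, IsPM lozenges (strip j n A W) M := by
  have hA0 : countLE A 0 = 0 := countLE_zero fun h => by simpa using hA h
  have hW0 : countLE W 0 = 0 := countLE_zero fun h => by simpa using hW h
  have h1 : ∀ k, countLE W (k + 1) ≤ countLE A (k + 1) := fun k => (h _).1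
  have h2 : ∀ k, countLE A (k + 1) ≤ countLE W k + 1 := fun k => (h (k + 1)).2 (by omega)
  have h0 : ∀ k, countLE W k ≤ countLE A k := fun k => (h _).1
  have hstep : ∀ (S : Finset ℕ) k, (k + 1 ∈ S ∧ countLE S (k + 1) = countLE S k + 1) ∨
      (k + 1 ∉ S ∧ countLE S (k + 1) = countLE S k) := by
    intro S k
    by_cases hk : k + 1 ∈ S
    · exact Or.inl ⟨hk, countLE_succ_of_mem hk⟩
    · exact Or.inr ⟨hk, countLE_succ_of_notMem hk⟩
  have hlast : ∀ k, n = k + 1 → countLE A (k + 1) = countLE W k + 1 := by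
    rintro k rfl
    rw [countLE_of_forall_le fun x hx => (mem_Icc.1 (hA hx)).2,
      countLE_of_forall_le fun x hx => by have := mem_Ico.1 (hW hx); omega, hcard]
  let r : Finset ℕ := (Icc 1 n \ A).filter fun k => countLE A k = countLE W (k - 1)
  let l : Finset ℕ := (Ico 1 n \ W).filter fun k => k + 1 ∉ A ∧ countLE A (k + 1) = countLE W k + 1
  have hr : ∀ k, k + 1 ∈ r ↔ k + 1 ≤ n ∧ k + 1 ∉ A ∧ countLE A (k + 1) = countLE W k := by
    intro k
    simp only [r, mem_filter, mem_sdiff, mem_Icc, Nat.add_sub_cancel]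
    constructor
    · rintro ⟨⟨⟨-, h3⟩, h4⟩, h5⟩; exact ⟨h3, h4, h5⟩
    · rintro ⟨h3, h4, h5⟩; exact ⟨⟨⟨by omega, h3⟩, h4⟩, h5⟩
  have hr0 : 0 ∉ r := by simp [r]
  have hl : ∀ k, k ∈ l ↔ 1 ≤ k ∧ k < n ∧ k ∉ W ∧ k + 1 ∉ A ∧
      countLE A (k + 1) = countLE W k + 1 := by
    intro k
    simp only [l, mem_filter, mem_sdiff, mem_Ico]
    tauto
  refine ⟨r.image (rightLozenge j) ∪ l.image (leftLozenge j), fun b hb => ?_, fun t ht => ?_⟩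
  · rw [mem_union, mem_image, mem_image] at hb
    rcases hb with ⟨k, hk, rfl⟩ | ⟨k, hk, rfl⟩
    · refine ⟨rightLozenge_mem j k, rightLozenge_subset.2 ?_⟩
      obtain _ | k := k
      · exact absurd hk hr0
      obtain ⟨h3, h4, h5⟩ := (hr k).1 hk
      refine ⟨by omega, lt_of_le_of_ne h3 fun h6 => ?_, h4, fun h6 => ?_⟩
      · have := hlast k h6.symm; omega
      · have := countLE_succ_of_mem h6
        have := h1 k
        omega
    · obtain ⟨h3, h4, h5, h6, -⟩ := (hl k).1 hk
      exact ⟨leftLozenge_mem j k, leftLozenge_subset.2 ⟨h3, h4, h6, h5⟩⟩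
  · simp only [mem_union, mem_image]
    obtain ⟨k, rfl | rfl⟩ := exists_of_mem_strip ht
    · obtain ⟨-, h3, h4, h5⟩ := up_mem_strip.1 ht
      obtain ⟨k, rfl⟩ := Nat.exists_eq_add_of_le' h3
      have hs := hstep A k
      by_cases h6 : countLE A (k + 1) = countLE W k
      · refine ⟨rightLozenge j (k + 1), ⟨Or.inl ⟨_, (hr k).2 ⟨h4, h5, h6⟩, rfl⟩, ?_⟩, ?_⟩
        · exact up_mem_rightLozenge.2 rfl
        rintro b ⟨⟨i, hi, rfl⟩ | ⟨i, hi, rfl⟩, hb⟩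
        · rw [up_mem_rightLozenge.1 hb]
        · have h7 := up_mem_leftLozenge.1 hb
          obtain rfl : k = i := by omega
          have := ((hl k).1 hi).2.2.2.2
          omega
      · have h7 := h0 k
        have h8 := h2 k
        have h9 : countLE A (k + 1) = countLE W k + 1 := by
          rcases hs with hs | hs
          · exact absurd hs.1 h5
          · omega
        have hk : k ∈ l := by
          rw [hl]
          have hk1 : 1 ≤ k := by
            rcases Nat.eq_zero_or_pos k with rfl | hk
            · rcases hs with hs | hs
              · exact absurd hs.1 h5
              · omega
            · exact hk
          refine ⟨hk1, by omega, fun h10 => ?_, h5, h9⟩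
          obtain ⟨k, rfl⟩ := Nat.exists_eq_add_of_le' hk1
          have := countLE_succ_of_mem h10
          have := h2 k
          rcases hs with hs | hs
          · exact absurd hs.1 h5
          · omega
        refine ⟨leftLozenge j k, ⟨Or.inr ⟨_, hk, rfl⟩, up_mem_leftLozenge.2 rfl⟩, ?_⟩
        rintro b ⟨⟨i, hi, rfl⟩ | ⟨i, hi, rfl⟩, hb⟩
        · have h7 := up_mem_rightLozenge.1 hb
          subst h7
          exact absurd ((hr k).1 hi).2.2 h6
        · have h7 := up_mem_leftLozenge.1 hb
          obtain rfl : k = i := by omega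
          rfl
    · obtain ⟨-, h3, h4, h5⟩ := down_mem_strip.1 ht
      obtain ⟨k, rfl⟩ := Nat.exists_eq_add_of_le' h3
      have hs := hstep A k
      have hs' := hstep A (k + 1)
      have hw := countLE_succ_of_notMem h5
      have h7 := h0 k
      have h8 := h2 k
      have h9 := h2 (k + 1)
      have h10 := h0 (k + 1)
      by_cases h6 : countLE A (k + 1) = countLE W k
      · have h11 : k + 1 ∉ A := by
          rcases hs with hs | hs
          · omega
          · exact hs.1
        refine ⟨rightLozenge j (k + 1), ⟨Or.inl ⟨_, (hr k).2 ⟨h4.le, h11, h6⟩, rfl⟩, ?_⟩, ?_⟩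
        · exact down_mem_rightLozenge.2 rfl
        rintro b ⟨⟨i, hi, rfl⟩ | ⟨i, hi, rfl⟩, hb⟩
        · rw [down_mem_rightLozenge.1 hb]
        · have h12 := down_mem_leftLozenge.1 hb
          subst h12
          obtain ⟨-, -, -, h13, h14⟩ := (hl (k + 1)).1 hi
          rcases hs' with hs' | hs'
          · exact absurd hs'.1 h13
          · omega
      · have h11 : k + 1 + 1 ∉ A ∧ countLE A (k + 1 + 1) = countLE W (k + 1) + 1 := by
          rcases hs' with hs' | hs'
          · omega
          · exact ⟨hs'.1, by omega⟩
        refine ⟨leftLozenge j (k + 1), ⟨Or.inr ⟨_, (hl _).2 ⟨h3, h4, h5, h11⟩, rfl⟩,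
          down_mem_leftLozenge.2 rfl⟩, ?_⟩
        rintro b ⟨⟨i, hi, rfl⟩ | ⟨i, hi, rfl⟩, hb⟩
        · have h12 := down_mem_rightLozenge.1 hb
          subst h12
          exact absurd ((hr k).1 hi).2.2 h6
        · rw [down_mem_leftLozenge.1 hb]

/-! ### Interlacing sequences and counting functions. -/

theorem countLE_image {d : ℕ} {a : Fin d → ℕ} (ha : StrictMono a) (k : ℕ) :
    countLE (univ.image a) k = (univ.filter fun i => a i ≤ k).card := by
  rw [countLE, Finset.filter_image, Finset.card_image_of_injective _ ha.injective]

theorem countLE_le_of_lt {d : ℕ} {a : Fin d → ℕ} (ha : StrictMono a) {i : Fin d} {k : ℕ}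
    (h : k < a i) : countLE (univ.image a) k ≤ i := by
  rw [countLE_image ha, ← Fin.card_Iio i]
  refine Finset.card_le_card fun l hl => ?_
  rw [mem_filter] at hl
  exact mem_Iio.2 (ha.lt_iff_lt.1 (hl.2.trans_lt h))

theorem lt_countLE_of_le {d : ℕ} {a : Fin d → ℕ} (ha : StrictMono a) {i : Fin d} {k : ℕ}
    (h : a i ≤ k) : (i : ℕ) < countLE (univ.image a) k := by
  rw [countLE_image ha, ← Nat.succ_le_iff, Nat.succ_eq_add_one, ← Fin.card_Iic i]
  refine Finset.card_le_card fun l hl => ?_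
  rw [mem_filter]
  exact ⟨mem_univ _, (ha.monotone (mem_Iic.1 hl)).trans h⟩

theorem strictMono_of_interlacing {d : ℕ} {a : Fin (d + 1) → ℕ} {w : Fin d → ℕ}
    (hw : w ∈ Fintype.piFinset fun i : Fin d => Ico (a i.castSucc) (a i.succ))
    (ha : StrictMono a) : StrictMono w := by
  intro i i' h
  have h1 := mem_Ico.1 (Fintype.mem_piFinset.1 hw i)
  have h2 := mem_Ico.1 (Fintype.mem_piFinset.1 hw i')
  have h3 : a i.succ ≤ a i'.castSucc := ha.monotone (by simpa [Fin.le_def] using h)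
  omega

/-- The interlacing condition in terms of counting functions. -/
theorem interlacing_iff {d : ℕ} {a : Fin (d + 1) → ℕ} (ha : StrictMono a) :
    ((∀ k, countLE W k ≤ countLE (univ.image a) k ∧
        (1 ≤ k → countLE (univ.image a) k ≤ countLE W (k - 1) + 1)) ∧
      (univ.image a).card = W.card + 1) ↔
    ∃ w ∈ Fintype.piFinset fun i : Fin d => Ico (a i.castSucc) (a i.succ), univ.image w = W := by
  have hcard : (univ.image a).card = d + 1 := by
    rw [Finset.card_image_of_injective _ ha.injective, Finset.card_univ, Fintype.card_fin]
  rw [hcard]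
  constructor
  · rintro ⟨h, hc⟩
    have hWd : W.card = d := by omega
    obtain ⟨w, hw, rfl⟩ : ∃ w : Fin d → ℕ, StrictMono w ∧ univ.image w = W :=
      ⟨W.orderEmbOfFin hWd, (W.orderEmbOfFin hWd).strictMono, Finset.image_orderEmbOfFin_univ _ _⟩
    refine ⟨w, Fintype.mem_piFinset.2 fun i => mem_Ico.2 ⟨?_, ?_⟩, rfl⟩
    -- If `w i < a i`, then at most `i` terms of `a` but at least `i + 1` terms of `w` are `≤ w i`.
    -- The other bound is proved in the same way at `a i.succ - 1`.
    · by_contra! hlt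
      have h1 := countLE_le_of_lt ha hlt
      have h2 := lt_countLE_of_le hw (le_refl (w i))
      have h3 := (h (w i)).1
      simp only [Fin.val_castSucc] at h1
      omega
    · by_contra! hle
      have h1 := lt_countLE_of_le ha (le_refl (a i.succ))
      have h4 : 1 ≤ a i.succ := by
        have := ha (Fin.castSucc_lt_succ (i := i)); omega
      have h2 := countLE_le_of_lt hw (show a i.succ - 1 < w i by omega)
      have h3 := (h (a i.succ)).2 h4
      simp only [Fin.val_succ] at h1
      omega
  · rintro ⟨w, hw, rfl⟩
    have hwm := strictMono_of_interlacing hw ha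
    have hI := fun i => mem_Ico.1 (Fintype.mem_piFinset.1 hw i)
    refine ⟨fun k => ⟨?_, fun hk => ?_⟩, ?_⟩
    · rw [countLE_image ha, countLE_image hwm]
      refine Finset.card_le_card_of_injOn Fin.castSucc ?_ (Fin.castSucc_injective d).injOn
      intro i hi
      simp only [coe_filter, mem_univ, true_and, Set.mem_ofPred_eq] at hi ⊢
      exact (hI i).1.trans hi
    · rw [countLE_image ha, countLE_image hwm]
      -- Every term of `a` except `a 0` is preceded by a strictly smaller term of `w`. The exception
      -- accounts for the `+ 1`.
      have hsub : (univ.filter fun i => a i ≤ k) ⊆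
          insert 0 ((univ.filter fun i => w i ≤ k - 1).image Fin.succ) := by
        intro i hi
        rw [mem_filter] at hi
        obtain rfl | ⟨i, rfl⟩ := Fin.eq_zero_or_eq_succ i
        · simp
        · refine mem_insert_of_mem (mem_image_of_mem _ (mem_filter.2 ⟨mem_univ _, ?_⟩))
          have := (hI i).2
          omega
      refine (Finset.card_le_card hsub).trans ((Finset.card_insert_le _ _).trans ?_)
      rw [Finset.card_image_of_injective _ (Fin.succ_injective d)]
    · rw [Finset.card_image_of_injective _ hwm.injective, Finset.card_univ, Fintype.card_fin]

/-- A row has exactly one tiling if the missing triangles interlace. -/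
theorem card_pms_strip_of_interlacing (hA : A ⊆ Icc 1 n) (hW : W ⊆ Ico 1 n)
    (h : (∀ k, countLE W k ≤ countLE A k ∧ (1 ≤ k → countLE A k ≤ countLE W (k - 1) + 1)) ∧
      A.card = W.card + 1) : (pms lozenges (strip j n A W)).card = 1 := by
  obtain ⟨M, hM⟩ := exists_isPM_strip (j := j) hA hW h.1 h.2
  rw [Finset.card_eq_one]
  refine ⟨M, ?_⟩
  ext M'
  rw [mem_pms, mem_singleton]
  exact ⟨fun h => h.strip_unique hM hA hW, fun h => h ▸ hM⟩

/-- A row has no tiling if the missing triangles do not interlace. -/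
theorem interlacing_of_card_pms_strip_ne_zero (hA : A ⊆ Icc 1 n) (hW : W ⊆ Ico 1 n) (hn : 1 ≤ n)
    (h : (pms lozenges (strip j n A W)).card ≠ 0) :
    (∀ k, countLE W k ≤ countLE A k ∧ (1 ≤ k → countLE A k ≤ countLE W (k - 1) + 1)) ∧
      A.card = W.card + 1 := by
  obtain ⟨M, hM⟩ := Finset.card_ne_zero.1 h
  exact (mem_pms.1 hM).strip_countLE hA hW hn

end Strip

/-! ## Half hexagons -/

theorem up_mem_hexagon {N m n : ℕ} {i r : ℤ} :
    up i r ∈ hexagon N m n ↔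
      1 ≤ i ∧ i ≤ N ∧ 1 ≤ i + r ∧ i + r ≤ N ∧ -(n : ℤ) ≤ r ∧ r + 1 ≤ m := by
  rw [mem_hexagon]
  simp only [up, vertices, mem_insert, mem_singleton, forall_eq_or_imp, forall_eq, InHexagon]
  omega

theorem down_mem_hexagon {N m n : ℕ} {i r : ℤ} :
    down i r ∈ hexagon N m n ↔
      1 ≤ i ∧ i ≤ N ∧ 0 ≤ i + r ∧ i + r + 1 ≤ N ∧ -(n : ℤ) ≤ r ∧ r + 1 ≤ m := by
  rw [mem_hexagon]
  simp only [down, vertices, mem_insert, mem_singleton, forall_eq_or_imp, forall_eq, InHexagon]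
  omega

/-- The part of the hexagon at height at least `j` above the diagonal. -/
noncomputable def upperPart (N m j : ℕ) : Finset Tri :=
  (hexagon N m 0).filter fun t => (j : ℤ) ≤ t.2.1

theorem up_mem_upperPart {N m j : ℕ} {i r : ℤ} :
    up i r ∈ upperPart N m j ↔ 1 ≤ i ∧ i + r ≤ N ∧ (j : ℤ) ≤ r ∧ r + 1 ≤ m := by
  rw [upperPart, mem_filter, up_mem_hexagon]
  simp only [up]
  omega

theorem down_mem_upperPart {N m j : ℕ} {i r : ℤ} :
    down i r ∈ upperPart N m j ↔ 1 ≤ i ∧ i + r + 1 ≤ N ∧ (j : ℤ) ≤ r ∧ r + 1 ≤ m := by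
  rw [upperPart, mem_filter, down_mem_hexagon]
  simp only [down]
  omega

/-- The upper part of the hexagon without the upwards-pointing triangles at the positions in `A`
along its lower side. -/
noncomputable def dentedPart (N m j : ℕ) (A : Finset ℕ) : Finset Tri :=
  upperPart N m j \ A.image fun k : ℕ => up k j

theorem dentedPart_sdiff (N m j : ℕ) (A W : Finset ℕ) :
    dentedPart N m j A \ W.image (fun k : ℕ => up k j) = dentedPart N m j (A ∪ W) := by
  rw [dentedPart, dentedPart, image_union, sdiff_sdiff_left]
  rfl

theorem le_of_mem_dentedPart {N m j : ℕ} {A : Finset ℕ} {t : Tri} (h : t ∈ dentedPart N m j A) :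
    (j : ℤ) ≤ t.2.1 :=
  (mem_filter.1 (mem_sdiff.1 h).1).2

theorem up_mem_dentedPart {N m j : ℕ} {A : Finset ℕ} {k : ℕ} {r : ℤ} :
    up k r ∈ dentedPart N m j A ↔
      1 ≤ k ∧ k + r ≤ N ∧ (j : ℤ) ≤ r ∧ r + 1 ≤ m ∧ ¬ (r = j ∧ k ∈ A) := by
  rw [dentedPart, mem_sdiff, up_mem_upperPart, mem_image]
  simp only [up_inj, Nat.cast_inj]
  constructor
  · rintro ⟨⟨h1, h2, h3, h4⟩, h5⟩
    exact ⟨by omega, h2, h3, h4, fun h => h5 ⟨k, h.2, rfl, h.1.symm⟩⟩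
  · rintro ⟨h1, h2, h3, h4, h5⟩
    refine ⟨⟨by omega, h2, h3, h4⟩, ?_⟩
    rintro ⟨l, hl, rfl, rfl⟩
    exact h5 ⟨rfl, hl⟩

theorem dentedPart_eq_union {N m j : ℕ} (hj : j < m) (hm : m ≤ N) (A : Finset ℕ) :
    dentedPart N m j A = upperPart N m (j + 1) ∪ strip j (N - j) A ∅ := by
  ext t
  obtain ⟨i, r, rfl | rfl⟩ := exists_eq_up_or_down t
  · by_cases hi : 0 ≤ i
    · obtain ⟨k, rfl⟩ := Int.eq_ofNat_of_zero_le hi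
      rw [mem_union, up_mem_dentedPart, up_mem_upperPart, up_mem_strip]
      by_cases hk : k ∈ A
      · simp only [hk, not_true, and_false, or_false, and_true]; omega
      · simp only [hk, not_false_iff, and_true, and_false]; omega
    · rw [dentedPart, mem_union, mem_sdiff, up_mem_upperPart, up_mem_upperPart]
      constructor
      · rintro ⟨h, -⟩; omega
      · rintro (h | h)
        · omega
        · obtain ⟨k, h | h⟩ := exists_of_mem_strip h
          · have := (up_inj.1 h).1; omega
          · exact absurd h up_ne_down
  · rw [dentedPart, mem_union, mem_sdiff, down_mem_upperPart, down_mem_upperPart]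
    have : down i r ∉ A.image fun k : ℕ => up k j := by simp
    simp only [this, not_false_iff, and_true]
    by_cases hi : 0 ≤ i
    · obtain ⟨k, rfl⟩ := Int.eq_ofNat_of_zero_le hi
      rw [down_mem_strip]
      simp only [notMem_empty, not_false_iff, and_true]
      omega
    · constructor
      · intro h; omega
      · rintro (h | h)
        · omega
        · obtain ⟨k, h | h⟩ := exists_of_mem_strip h
          · exact absurd h down_ne_up
          · have := (down_inj.1 h).1; omega

theorem strip_sdiff (j n : ℕ) (A W : Finset ℕ) :
    strip j n A ∅ \ W.image (fun k : ℕ => down k j) = strip j n A W := by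
  ext t
  rw [mem_sdiff]
  constructor
  · rintro ⟨h1, h2⟩
    obtain ⟨k, rfl | rfl⟩ := exists_of_mem_strip h1
    · rw [up_mem_strip] at h1 ⊢
      exact h1
    · rw [down_mem_strip] at h1 ⊢
      exact ⟨h1.1, h1.2.1, h1.2.2.1, fun h => h2 (mem_image_of_mem (fun k : ℕ => down k j) h)⟩
  · intro h1
    obtain ⟨k, rfl | rfl⟩ := exists_of_mem_strip h1
    · rw [up_mem_strip] at h1 ⊢
      exact ⟨h1, by simp⟩
    · rw [down_mem_strip] at h1 ⊢
      exact ⟨⟨h1.1, h1.2.1, h1.2.2.1, notMem_empty _⟩, by simpa using h1.2.2.2⟩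

theorem row_of_mem_strip {j n : ℕ} {A W : Finset ℕ} {t : Tri} (h : t ∈ strip j n A W) :
    t.2.1 = j := by
  obtain ⟨k, rfl | rfl⟩ := exists_of_mem_strip h <;> rfl

/-- Recursion for the number of tilings of a dented half hexagon, from its lowest row. -/
theorem card_pms_dentedPart_succ {N m j : ℕ} (hj : j < m) (hm : m ≤ N) (A : Finset ℕ) :
    ∃ K : Finset ℕ, (∀ k : ℕ, k ∈ K ↔ k ∈ Ico 1 (N - j) ∧ j + 1 < m) ∧
      (pms lozenges (dentedPart N m j A)).card =
        ∑ W ∈ K.powerset, (pms lozenges (dentedPart N m (j + 1) W)).card *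
          (pms lozenges (strip j (N - j) A W)).card := by
  classical
  have hj1 : ((j + 1 : ℕ) : ℤ) - 1 = j := by push_cast; ring
  -- In the top row, `j + 1 = m`, this set is empty: there is nothing above to cross into.
  refine ⟨(Ico 1 (N - j)).filter fun _ => j + 1 < m, fun k => mem_filter, ?_⟩
  have h := card_cut_eq_sum (R₁ := upperPart N m (j + 1)) (R₂ := strip j (N - j) A ∅)
    (c := ((j + 1 : ℕ) : ℤ)) (K := (Ico 1 (N - j)).filter fun _ => j + 1 < m)
    (fun t ht => (mem_filter.1 ht).2)
    (fun t ht => by rw [row_of_mem_strip ht]; push_cast; omega)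
    (fun i hi => by have := up_mem_upperPart.1 hi; omega)
    (fun k => by
      rw [hj1, up_mem_upperPart, down_mem_strip, mem_filter, mem_Ico]
      simp only [notMem_empty, not_false_iff, and_true, true_and]
      omega)
    ((Ico 1 (N - j)).filter fun _ => j + 1 < m)
  -- With the set of all possible crossing positions as the allowed set, the restriction on
  -- crossings is vacuous.
  rw [inter_self, ← dentedPart_eq_union hj hm, Finset.filter_true_of_mem] at h
  · rw [h]
    refine Finset.sum_congr rfl fun W _ => ?_
    rw [hj1, strip_sdiff]
    rfl
  · intro M hM k hk
    have hb := ((mem_pms.1 hM).1 _ hk).2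
    rw [dentedPart_eq_union hj hm, insert_subset_iff, singleton_subset_iff, mem_union, mem_union,
      hj1, up_mem_upperPart, up_mem_strip, down_mem_upperPart, down_mem_strip] at hb
    rw [mem_filter, mem_Ico]
    simp only [notMem_empty, not_false_iff, and_true] at hb
    omega

theorem P_empty_left (A : Finset ℕ) : P ∅ A = 1 := by simp [P]

/-- The number of tilings of a dented half hexagon. -/
theorem card_pms_dentedPart {N m : ℕ} (hm : m ≤ N) (d j : ℕ) (hd : m = j + d) (A : Finset ℕ)
    (hA : ∀ k ∈ A, up k j ∈ upperPart N m j) :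
    ((pms lozenges (dentedPart N m j A)).card : ℚ) =
      if A.card = d then P A A / superfact d else 0 := by
  induction d generalizing j A with
  | zero =>
    have hR : upperPart N m j = ∅ := by
      refine Finset.eq_empty_of_forall_notMem fun t ht => ?_
      obtain ⟨i, r, rfl | rfl⟩ := exists_eq_up_or_down t
      · rw [up_mem_upperPart] at ht; omega
      · rw [down_mem_upperPart] at ht; omega
    obtain rfl : A = ∅ := Finset.eq_empty_of_forall_notMem fun k hk => by
      have := hA k hk
      rw [hR] at this
      exact notMem_empty _ this
    have : pms lozenges (dentedPart N m j ∅) = {∅} := by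
      ext M
      rw [mem_pms, mem_singleton, dentedPart, hR]
      constructor
      · intro h
        refine Finset.eq_empty_of_forall_notMem fun b hb => ?_
        have h1 := h.1 b hb
        rw [empty_sdiff, subset_empty] at h1
        exact empty_notMem_lozenges (h1.2 ▸ h1.1)
      · rintro rfl
        exact ⟨by simp, by simp⟩
    rw [this]
    simp [P_empty_left, superfact]
  | succ d ih =>
    obtain ⟨K, hK, hrec⟩ := card_pms_dentedPart_succ (N := N) (m := m) (j := j) (by omega) hm A
    have hA' : A ⊆ Icc 1 (N - j) := fun k hk => by
      have := up_mem_upperPart.1 (hA k hk)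
      rw [mem_Icc]; omega
    have hKn : ∀ W ∈ K.powerset, W ⊆ Ico 1 (N - j) := fun W hW k hk =>
      ((hK k).1 (mem_powerset.1 hW hk)).1
    have hih : ∀ W ∈ K.powerset, ((pms lozenges (dentedPart N m (j + 1) W)).card : ℚ) =
        if W.card = d then P W W / superfact d else 0 := fun W hW =>
      ih (j + 1) (by omega) W fun k hk => by
        obtain ⟨h1, h2⟩ := (hK k).1 (mem_powerset.1 hW hk)
        rw [mem_Ico] at h1
        rw [up_mem_upperPart]
        push_cast
        omega
    rw [hrec]
    push_cast
    split_ifs with hAd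
    · let a : Fin (d + 1) → ℕ := ⇑(A.orderEmbOfFin hAd)
      have ham : StrictMono a := (A.orderEmbOfFin hAd).strictMono
      have hAa : univ.image a = A := Finset.image_orderEmbOfFin_univ _ _
      have haA : ∀ i, a i ∈ Icc 1 (N - j) := fun i => hA' (by
        rw [← hAa]; exact mem_image_of_mem _ (mem_univ i))
      set S := Fintype.piFinset fun i : Fin d => Ico (a i.castSucc) (a i.succ) with hS
      have hSK : S.image (fun w => univ.image w) ⊆ K.powerset := by
        intro W hW
        obtain ⟨w, hw, rfl⟩ := mem_image.1 hW
        refine mem_powerset.2 fun k hk => ?_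
        obtain ⟨i, -, rfl⟩ := mem_image.1 hk
        rw [hK, mem_Ico]
        have h1 := mem_Ico.1 (Fintype.mem_piFinset.1 hw i)
        have h2 := mem_Icc.1 (haA i.castSucc)
        have h3 := mem_Icc.1 (haA i.succ)
        have h4 := i.pos
        omega
      -- Only sets interlacing with `A` leave a tileable lowest row. Over these the sum is the one
      -- evaluated by `sum_binomDet`.
      rw [← Finset.sum_subset hSK, Finset.sum_image]
      · rw [← hAa, ← binomDet_eq ham, ← sum_binomDet ham]
        refine Finset.sum_congr rfl fun w hw => ?_
        have hwm := strictMono_of_interlacing hw ham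
        have hWK := hSK (mem_image_of_mem _ hw)
        rw [hih _ hWK, hAa, card_pms_strip_of_interlacing hA' (hKn _ hWK), binomDet_eq hwm,
          Finset.card_image_of_injective _ hwm.injective, Finset.card_univ, Fintype.card_fin]
        · simp
        · rw [← hAa]
          exact (interlacing_iff ham).2 ⟨w, hw, rfl⟩
      · intro w hw w' hw' h
        have h1 := strictMono_of_interlacing hw ham
        have h2 := strictMono_of_interlacing hw' ham
        refine (h1.range_inj h2).1 ?_
        have h3 := congrArg (fun s : Finset ℕ => (s : Set ℕ)) h
        simpa using h3
      · intro W hW hWS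
        rw [mul_eq_zero]
        right
        by_contra hne
        have h1 := interlacing_of_card_pms_strip_ne_zero hA' (hKn W hW) (by omega)
          (by exact_mod_cast hne)
        rw [← hAa, interlacing_iff ham] at h1
        obtain ⟨w, hw, rfl⟩ := h1
        exact hWS (mem_image_of_mem _ hw)
    -- A tileable row forces `|A| = |W| + 1`, so `|W| ≠ d` and the part above the row has no tiling.
    · refine Finset.sum_eq_zero fun W hW => ?_
      by_cases hne : ((pms lozenges (strip j (N - j) A W)).card) = 0
      · rw [hne]; simp
      · have h1 := interlacing_of_card_pms_strip_ne_zero hA' (hKn W hW) (by omega) hne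
        rw [hih W hW, if_neg (by omega), zero_mul]

/-! ## The products `P A B` -/

theorem P_pos (A B : Finset ℕ) : 0 < P A B :=
  Finset.prod_pos fun p hp => sub_pos.2 (by exact_mod_cast (mem_filter.1 hp).2)

theorem P_union_left {A A' : Finset ℕ} (h : Disjoint A A') (B : Finset ℕ) :
    P (A ∪ A') B = P A B * P A' B := by
  rw [P, Finset.union_product, Finset.filter_union, Finset.prod_union]
  · rfl
  · exact Finset.disjoint_filter_filter (Finset.disjoint_product.2 (Or.inl h))

theorem P_union_right {B B' : Finset ℕ} (h : Disjoint B B') (A : Finset ℕ) :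
    P A (B ∪ B') = P A B * P A B' := by
  rw [P, Finset.product_union, Finset.filter_union, Finset.prod_union]
  · rfl
  · exact Finset.disjoint_filter_filter (Finset.disjoint_product.2 (Or.inr h))

theorem prefactor_pos (U L : Finset ℕ) : 0 < prefactor U L :=
  div_pos (mul_pos (P_pos _ _) (P_pos _ _)) (mul_pos (superfact_pos _) (superfact_pos _))

/-- `P` only involves pairs in increasing order, so every summand is positive, and `|V| ≤ |B|`
provides a summand. -/
theorem positionSum_pos {U L V B : Finset ℕ} (h : V.card ≤ B.card) :
    0 < positionSum U L V B :=
  Finset.sum_pos (fun _ _ => mul_pos (mul_pos (P_pos _ _) (P_pos _ _)) (pow_pos (P_pos _ _) 2))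
    (Finset.powersetCard_nonempty.2 h)

/-! ## Dented hexagons -/

section Hexagon

variable {N : ℕ} {U L V B W : Finset ℕ}

/-- The part of the dented hexagon below the diagonal. -/
noncomputable def lowerHalf (N : ℕ) (L V : Finset ℕ) : Finset Tri :=
  (dentedPart N L.card 0 (L \ V)).image flip

theorem row_of_mem_lowerHalf {t : Tri} (ht : t ∈ lowerHalf N L V) : t.2.1 < ((0 : ℕ) : ℤ) := by
  rw [lowerHalf, mem_image_flip] at ht
  have := le_of_mem_dentedPart ht
  obtain ⟨i, r, rfl | rfl⟩ := exists_eq_up_or_down t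
  · simp only [flip_up] at this
    simp only [down, up] at this ⊢
    omega
  · simp only [flip_down] at this
    simp only [down, up] at this ⊢
    omega

theorem diagLozenge_eq (k : ℕ) :
    diagLozenge k = {up k ((0 : ℕ) : ℤ), down k (((0 : ℕ) : ℤ) - 1)} := rfl

theorem dentedHexagon_eq (N : ℕ) (U L V : Finset ℕ) :
    dentedHexagon N U L V = dentedPart N U.card 0 (U \ V) ∪ lowerHalf N L V := by
  ext t
  rw [lowerHalf, mem_union, mem_image_flip, dentedHexagon, dentedPart, dentedPart]
  simp only [mem_sdiff, mem_union, mem_image, upAt, downAt, not_or]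
  obtain ⟨i, r, rfl | rfl⟩ := exists_eq_up_or_down t
  · rw [up_mem_hexagon, flip_up, up_mem_upperPart, down_mem_upperPart]
    simp only [up_inj, down_ne_up, up_ne_down, and_false, exists_false, not_false_iff, and_true]
    by_cases hr : 0 ≤ r
    · have : ¬ (0 ≤ -r - 1) := by omega
      push_cast
      simp only [this, false_and, and_false, or_false]
      refine and_congr (by omega) Iff.rfl
    · have : ¬ ∃ a, (a ∈ U ∧ a ∉ V) ∧ (a : ℤ) = i ∧ 0 = r := by
        rintro ⟨a, -, -, h⟩; omega
      push_cast
      simp only [this, not_false_iff, and_true]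
      omega
  · rw [down_mem_hexagon, flip_down, down_mem_upperPart, up_mem_upperPart]
    simp only [up_inj, down_inj, up_ne_down, and_false, exists_false, not_false_iff,
      and_true, true_and]
    have hex : (∃ a, (a ∈ L ∧ a ∉ V) ∧ (a : ℤ) = i ∧ -1 = r) ↔
        ∃ a, (a ∈ L ∧ a ∉ V) ∧ (a : ℤ) = i + r + 1 ∧ ((0 : ℕ) : ℤ) = -r - 1 := by
      refine exists_congr fun a => and_congr Iff.rfl ?_
      push_cast; omega
    rw [hex]
    by_cases hr : 0 ≤ r
    · have : ¬ ∃ a, (a ∈ L ∧ a ∉ V) ∧ (a : ℤ) = i + r + 1 ∧ ((0 : ℕ) : ℤ) = -r - 1 := by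
        rintro ⟨a, -, -, h⟩; push_cast at h; omega
      simp only [this, not_false_iff, and_true]
      push_cast
      omega
    · have : ¬ (((0 : ℕ) : ℤ) ≤ r) := by push_cast; omega
      simp only [this, false_and, and_false, false_or]
      refine and_congr ?_ Iff.rfl
      push_cast
      omega

theorem down_mem_lowerHalf {k : ℕ} :
    down k (((0 : ℕ) : ℤ) - 1) ∈ lowerHalf N L V ↔
      1 ≤ k ∧ k ≤ N ∧ 1 ≤ L.card ∧ k ∉ L \ V := by
  have : flip (down k (((0 : ℕ) : ℤ) - 1)) = up k ((0 : ℕ) : ℤ) := by simp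
  rw [lowerHalf, mem_image_flip, this, up_mem_dentedPart]
  simp only [true_and]
  constructor
  · rintro ⟨h1, h2, h3, h4, h5⟩
    exact ⟨h1, by omega, by omega, h5⟩
  · rintro ⟨h1, h2, h3, h4⟩
    exact ⟨h1, by omega, le_rfl, by omega, h4⟩

theorem up_mem_upperHalf {k : ℕ} :
    up k ((0 : ℕ) : ℤ) ∈ dentedPart N U.card 0 (U \ V) ↔
      1 ≤ k ∧ k ≤ N ∧ 1 ≤ U.card ∧ k ∉ U \ V := by
  rw [up_mem_dentedPart]
  simp only [true_and]
  constructor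
  · rintro ⟨h1, h2, h3, h4, h5⟩
    exact ⟨h1, by omega, by omega, h5⟩
  · rintro ⟨h1, h2, h3, h4⟩
    exact ⟨h1, by omega, le_rfl, by omega, h4⟩

theorem card_pms_lowerHalf_sdiff (N : ℕ) (L V W : Finset ℕ) :
    (pms lozenges (lowerHalf N L V \ W.image fun k : ℕ => down k (((0 : ℕ) : ℤ) - 1))).card =
      (pms lozenges (dentedPart N L.card 0 (L \ V ∪ W))).card := by
  have : W.image (fun k : ℕ => down k (((0 : ℕ) : ℤ) - 1)) =
      (W.image fun k : ℕ => up k ((0 : ℕ) : ℤ)).image flip := by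
    rw [Finset.image_image]
    refine Finset.image_congr fun k _ => ?_
    simp
  rw [this, lowerHalf, ← Finset.image_sdiff _ _ flip_flip.injective, dentedPart_sdiff]
  exact card_pms_image flipEquiv (fun b => image_flip_mem_lozenges) _

theorem card_sdiff_union (hV : V ⊆ U) (h : Disjoint W (U \ V)) :
    (U \ V ∪ W).card = U.card ↔ W.card = V.card := by
  rw [Finset.card_union_of_disjoint h.symm, Finset.card_sdiff_of_subset hV]
  have := Finset.card_le_card hV
  omega

theorem card_pms_half (hU : U ⊆ Icc 1 N) (hV : V ⊆ U)
    (hW : ∀ k ∈ W, 1 ≤ k ∧ k ≤ N ∧ 1 ≤ U.card ∧ k ∉ U \ V) :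
    ((pms lozenges (dentedPart N U.card 0 (U \ V ∪ W))).card : ℚ) =
      if W.card = V.card then P (U \ V ∪ W) (U \ V ∪ W) / superfact U.card else 0 := by
  -- This bound makes every row nonempty. An empty row would have a tiling with no dent, against the
  -- product formula.
  have hUN : U.card ≤ N := by simpa using Finset.card_le_card hU
  rw [card_pms_dentedPart hUN U.card 0 (by simp)]
  · refine if_congr (card_sdiff_union hV ?_) rfl rfl
    exact Finset.disjoint_left.2 fun k hk => (hW k hk).2.2.2
  · intro k hk
    rw [up_mem_upperPart]
    rcases mem_union.1 hk with hk | hk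
    · have h1 := mem_Icc.1 (hU (mem_sdiff.1 hk).1)
      have h2 := Finset.card_pos.2 ⟨k, (mem_sdiff.1 hk).1⟩
      omega
    · have := hW k hk
      omega

/-- Every tiling of a dented hexagon has exactly `|V|` vertical lozenges on the diagonal. -/
theorem exists_diagonal_positions (hU : U ⊆ Icc 1 N) (hV : V ⊆ U ∩ L)
    (T : Finpartition (dentedHexagon N U L V)) (hT : IsTiling T) :
    ∃ W : Finset ℕ, (∀ k : ℕ, diagLozenge k ∈ T.parts ↔ k ∈ W) ∧
      W.card = V.card ∧ Disjoint W ((U ∪ L) \ V) := by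
  classical
  have hpm : IsPM lozenges (dentedHexagon N U L V) T.parts := isPM_parts T hT
  have hmem : ∀ k : ℕ, diagLozenge k ∈ T.parts →
      (1 ≤ k ∧ k ≤ N ∧ 1 ≤ U.card ∧ k ∉ U \ V) ∧ (1 ≤ k ∧ k ≤ N ∧ 1 ≤ L.card ∧ k ∉ L \ V) := by
    intro k hk
    have hs := (hpm.1 _ hk).2
    rw [dentedHexagon_eq, diagLozenge_eq, insert_subset_iff, singleton_subset_iff, mem_union,
      mem_union] at hs
    refine ⟨up_mem_upperHalf.1 (hs.1.resolve_right fun h => ?_),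
      down_mem_lowerHalf.1 (hs.2.resolve_left fun h => ?_)⟩
    · simpa [up] using row_of_mem_lowerHalf h
    · simpa [down] using le_of_mem_dentedPart h
  let W : Finset ℕ := (Icc 1 N).filter fun k => diagLozenge k ∈ T.parts
  have hW : ∀ k : ℕ, diagLozenge k ∈ T.parts ↔ k ∈ W := fun k => by
    rw [mem_filter, mem_Icc]
    exact ⟨fun h => ⟨⟨(hmem k h).1.1, (hmem k h).1.2.1⟩, h⟩, fun h => h.2⟩
  have hWU : ∀ k ∈ W, 1 ≤ k ∧ k ≤ N ∧ 1 ≤ U.card ∧ k ∉ U \ V := fun k hk =>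
    (hmem k ((hW k).2 hk)).1
  have hWL : ∀ k ∈ W, 1 ≤ k ∧ k ≤ N ∧ 1 ≤ L.card ∧ k ∉ L \ V := fun k hk =>
    (hmem k ((hW k).2 hk)).2
  refine ⟨W, hW, ?_, ?_⟩
  · have h := card_filter_cut_eq (R₁ := dentedPart N U.card 0 (U \ V)) (R₂ := lowerHalf N L V)
      (c := ((0 : ℕ) : ℤ)) (W := W) (fun t => le_of_mem_dentedPart)
      (fun t => row_of_mem_lowerHalf)
      (fun i hi => by have := up_mem_upperPart.1 (mem_sdiff.1 hi).1; omega)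
      (fun k hk => up_mem_upperHalf.2 (hWU k hk)) (fun k hk => down_mem_lowerHalf.2 (hWL k hk))
    -- The given tiling is itself counted by the product in `h`, so the upper half has a tiling.
    -- This already forces the number of its dents.
    have hne : (pms lozenges (dentedPart N U.card 0 (U \ V ∪ W))).card ≠ 0 := by
      rw [← dentedHexagon_eq, dentedPart_sdiff] at h
      intro h0
      rw [h0, zero_mul, Finset.card_eq_zero] at h
      refine (Finset.eq_empty_iff_forall_notMem.1 h) T.parts (mem_filter.2 ⟨mem_pms.2 hpm, ?_⟩)
      exact hW
    by_contra hcard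
    have h1 := card_pms_half hU (hV.trans inter_subset_left) hWU
    rw [if_neg hcard] at h1
    exact hne (by exact_mod_cast h1)
  · refine Finset.disjoint_left.2 fun k hk h => ?_
    have h1 := (hWU k hk).2.2.2
    have h2 := (hWL k hk).2.2.2
    simp only [mem_sdiff, mem_union] at h h1 h2
    tauto

/-- Since `V ⊆ U ∩ L` and `W` avoids `(U ∪ L) \ V`, the dent set is the disjoint union of `bar U L`
and `X = ((U ∩ L) \ V) ∪ W`. This `X` is symmetric in `U` and `L`, so the two halves together
contribute `P X X ^ 2`. -/
theorem P_sdiff_union (hV : V ⊆ U ∩ L) (hW : Disjoint W ((U ∪ L) \ V)) :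
    P (U \ V ∪ W) (U \ V ∪ W) =
      P (bar U L) (bar U L) * P (bar U L) (((U ∩ L) \ V) ∪ W) *
        (P (((U ∩ L) \ V) ∪ W) (bar U L) *
          P (((U ∩ L) \ V) ∪ W) (((U ∩ L) \ V) ∪ W)) := by
  have hV' : ∀ k ∈ V, k ∈ U ∧ k ∈ L := fun k hk => mem_inter.1 (hV hk)
  have hW' := Finset.disjoint_left.1 hW
  have h1 : U \ V ∪ W = bar U L ∪ (((U ∩ L) \ V) ∪ W) := by
    ext k
    have := hV' k
    simp only [bar, mem_union, mem_sdiff, mem_inter]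
    tauto
  have h2 : Disjoint (bar U L) (((U ∩ L) \ V) ∪ W) := by
    refine Finset.disjoint_left.2 fun k hk h => ?_
    have h3 := hV' k
    have h4 := @hW' k
    simp only [bar, mem_union, mem_sdiff, mem_inter] at hk h h4
    tauto
  rw [h1, P_union_left h2, P_union_right h2, P_union_right h2]

/-- The number of tilings of a dented hexagon with restricted vertical lozenges on the diagonal. -/
theorem restrictedCount_eq (hU : U ⊆ Icc 1 N) (hL : L ⊆ Icc 1 N) (hB : B ⊆ Icc 1 N)
    (hV : V ⊆ U ∩ L) (hBF : Disjoint B ((U ∪ L) \ V)) :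
    (restrictedCount N U L V B : ℚ) = prefactor U L * positionSum U L V B := by
  classical
  have hVU : V ⊆ U := hV.trans inter_subset_left
  have hVL : V ⊆ L := hV.trans inter_subset_right
  -- These are the positions where both triangles at the diagonal are present. A half without rows
  -- has no triangles, hence the conditions on cardinalities.
  let K : Finset ℕ := (Icc 1 N).filter fun k =>
    (1 ≤ U.card ∧ k ∉ U \ V) ∧ (1 ≤ L.card ∧ k ∉ L \ V)
  have hK : ∀ k, k ∈ K ↔ (1 ≤ k ∧ k ≤ N ∧ 1 ≤ U.card ∧ k ∉ U \ V) ∧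
      (1 ≤ k ∧ k ≤ N ∧ 1 ≤ L.card ∧ k ∉ L \ V) := fun k => by
    simp only [K, mem_filter, mem_Icc]; tauto
  have h := card_cut_eq_sum (R₁ := dentedPart N U.card 0 (U \ V)) (R₂ := lowerHalf N L V)
    (c := ((0 : ℕ) : ℤ)) (K := K) (fun t => le_of_mem_dentedPart)
    (fun t => row_of_mem_lowerHalf)
    (fun i hi => by have := up_mem_upperPart.1 (mem_sdiff.1 hi).1; omega)
    (fun k => by rw [hK, up_mem_upperHalf, down_mem_lowerHalf]) B
  rw [← dentedHexagon_eq] at h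
  have hcount : restrictedCount N U L V B = _ :=
    (card_finpartition_eq empty_notMem_lozenges (dentedHexagon N U L V) fun M =>
      ∀ k : ℕ, diagLozenge k ∈ M → k ∈ B).trans h
  rw [hcount, Nat.cast_sum]
  simp only [Nat.cast_mul]
  have hterm : ∀ W ∈ (K ∩ B).powerset,
      ((pms lozenges (dentedPart N U.card 0 (U \ V) \
          W.image fun k : ℕ => up k ((0 : ℕ) : ℤ))).card : ℚ) *
        ((pms lozenges (lowerHalf N L V \
          W.image fun k : ℕ => down k (((0 : ℕ) : ℤ) - 1))).card : ℚ) =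
      if W.card = V.card then P (U \ V ∪ W) (U \ V ∪ W) / superfact U.card *
        (P (L \ V ∪ W) (L \ V ∪ W) / superfact L.card) else 0 := by
    intro W hW
    have hWK : ∀ k ∈ W, k ∈ K := fun k hk => (mem_inter.1 (mem_powerset.1 hW hk)).1
    rw [dentedPart_sdiff, card_pms_lowerHalf_sdiff,
      card_pms_half hU hVU fun k hk => ((hK k).1 (hWK k hk)).1,
      card_pms_half hL hVL fun k hk => ((hK k).1 (hWK k hk)).2]
    split_ifs <;> simp
  rw [Finset.sum_congr rfl hterm, ← Finset.sum_filter]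
  -- The restriction to `K` costs nothing: `B` avoids the dents, and a nonempty `W` with `|W| = |V|`
  -- makes `V`, hence `U` and `L`, nonempty.
  have hset : (K ∩ B).powerset.filter (fun W => W.card = V.card) = B.powersetCard V.card := by
    ext W
    simp only [mem_filter, mem_powerset, mem_powersetCard]
    refine and_congr_left fun hc => ⟨fun hW => hW.trans inter_subset_right, fun hW => ?_⟩
    refine subset_inter (fun k hk => ?_) hW
    have h1 := mem_Icc.1 (hB (hW hk))
    have h2 : 1 ≤ V.card := by rw [← hc]; exact Finset.card_pos.2 ⟨k, hk⟩
    have h3 := Finset.disjoint_left.1 hBF (hW hk)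
    have h4 := Finset.card_le_card hVU
    have h5 := Finset.card_le_card hVL
    rw [hK]
    refine ⟨⟨h1.1, h1.2, by omega, fun h => h3 ?_⟩, h1.1, h1.2, by omega, fun h => h3 ?_⟩
    · exact sdiff_subset_sdiff subset_union_left le_rfl h
    · exact sdiff_subset_sdiff subset_union_right le_rfl h
  rw [hset, positionSum, Finset.mul_sum]
  refine Finset.sum_congr rfl fun W hW => ?_
  have hWF : Disjoint W ((U ∪ L) \ V) :=
    Finset.disjoint_of_subset_left (mem_powersetCard.1 hW).1 hBF
  have hbar : Disjoint (bar U L) (bar L U) := Finset.disjoint_left.2 fun k h1 h2 => by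
    simp only [bar, mem_sdiff, mem_inter] at h1 h2
    tauto
  have hLU := P_sdiff_union (U := L) (L := U) (V := V) (W := W) (by rwa [inter_comm]) (by rwa [union_comm])
  rw [inter_comm L U] at hLU
  rw [P_sdiff_union hV hWF, hLU]
  simp only [P_union_left hbar, P_union_right hbar, prefactor]
  have := (superfact_pos U.card).ne'
  have := (superfact_pos L.card).ne'
  field_simp

end Hexagon

/-! ## Shuffling -/

section Shuffle

variable {U L V B S : Finset ℕ}

theorem shuffle_inter_shuffle (hS : S ⊆ bar U L ∪ bar L U) :
    shuffle U L S ∩ shuffle L U S = U ∩ L := by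
  ext k
  have := @hS k
  simp only [shuffle, bar, mem_union, mem_sdiff, mem_inter] at this ⊢
  tauto

theorem shuffle_union_shuffle (U L S : Finset ℕ) :
    shuffle U L S ∪ shuffle L U S = U ∪ L := by
  ext k
  simp only [shuffle, mem_union, mem_sdiff, mem_inter]
  tauto

theorem bar_union_bar (U L : Finset ℕ) : bar U L ∪ bar L U = (U ∪ L) \ (U ∩ L) := by
  ext k
  simp only [bar, mem_union, mem_sdiff, mem_inter]
  tauto

/-- The sum sees `U` and `L` only through their union and intersection. Exchanging elements of the
symmetric difference changes neither. -/
theorem positionSum_shuffle (hS : S ⊆ bar U L ∪ bar L U) (V B : Finset ℕ) :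
    positionSum (shuffle U L S) (shuffle L U S) V B = positionSum U L V B := by
  unfold positionSum
  rw [bar_union_bar, bar_union_bar, shuffle_inter_shuffle hS, shuffle_union_shuffle]

end Shuffle

end Lozenge

/-! ### The main theorem. -/

theorem mainTheorem2 (N : ℕ) (U L V B : Finset ℕ)
    (hU : U ⊆ Finset.Icc 1 N) (hL : L ⊆ Finset.Icc 1 N) (hB : B ⊆ Finset.Icc 1 N)
    (hV : V ⊆ U ∩ L) (hBF : Disjoint B ((U ∪ L) \ V)) :
    -- every tiling has exactly `|V|` vertical lozenges on the diagonal, away from `(U ∪ L) \ V`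
    (∀ T : Finpartition (Lozenge.dentedHexagon N U L V), Lozenge.IsTiling T →
      ∃ W : Finset ℕ, (∀ k : ℕ, Lozenge.diagLozenge k ∈ T.parts ↔ k ∈ W) ∧
        W.card = V.card ∧ Disjoint W ((U ∪ L) \ V)) ∧
    -- the number of restricted tilings
    (Lozenge.restrictedCount N U L V B : ℚ) =
      Lozenge.prefactor U L * Lozenge.positionSum U L V B ∧
    -- shuffling
    ∀ S : Finset ℕ, S ⊆ Lozenge.bar U L ∪ Lozenge.bar L U →
      ∀ U' L' : Finset ℕ, U' = Lozenge.shuffle U L S → L' = Lozenge.shuffle L U S →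
        Lozenge.positionSum U' L' V B = Lozenge.positionSum U L V B ∧
        (V.card ≤ B.card →
          0 < Lozenge.restrictedCount N U' L' V B ∧
          (Lozenge.restrictedCount N U L V B : ℚ) / (Lozenge.restrictedCount N U' L' V B : ℚ) =
            (Lozenge.P (Lozenge.bar U L) (Lozenge.bar U L) *
                Lozenge.P (Lozenge.bar L U) (Lozenge.bar L U)) /
              (Lozenge.P (Lozenge.bar U' L') (Lozenge.bar U' L') *
                Lozenge.P (Lozenge.bar L' U') (Lozenge.bar L' U')) *
            ((Lozenge.superfact U'.card * Lozenge.superfact L'.card) /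
              (Lozenge.superfact U.card * Lozenge.superfact L.card))) := by
  refine ⟨Lozenge.exists_diagonal_positions hU hV,
    Lozenge.restrictedCount_eq hU hL hB hV hBF, ?_⟩
  rintro S hS U' L' rfl rfl
  have hpos := Lozenge.positionSum_shuffle hS V B
  refine ⟨hpos, fun hVB => ?_⟩
  have hunion := Lozenge.shuffle_union_shuffle U L S
  have hsub : Lozenge.shuffle U L S ∪ Lozenge.shuffle L U S ⊆ Finset.Icc 1 N := by
    rw [hunion]; exact Finset.union_subset hU hL
  -- The conditions on `V` and `B` involve only the intersection and the union, so they carry over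
  -- to the shuffled sets.
  have hcount := Lozenge.restrictedCount_eq (V := V) (Finset.union_subset_left hsub)
    (Finset.union_subset_right hsub) hB (by rwa [Lozenge.shuffle_inter_shuffle hS])
    (by rwa [hunion])
  have hsum := Lozenge.positionSum_pos (U := U) (L := L) hVB
  rw [hpos] at hcount
  constructor
  · have : (0 : ℚ) <
        (Lozenge.restrictedCount N (Lozenge.shuffle U L S) (Lozenge.shuffle L U S) V B : ℚ) := by
      rw [hcount]
      exact mul_pos (Lozenge.prefactor_pos _ _) hsum
    exact_mod_cast this
  -- The common positive factor `positionSum` cancels, leaving the quotient of the prefactors.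
  · rw [hcount, Lozenge.restrictedCount_eq hU hL hB hV hBF, mul_div_mul_right _ _ hsum.ne',
      Lozenge.prefactor, Lozenge.prefactor, div_div_div_eq, div_mul_div_comm]
    congr 1
    ring
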